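/- Everything is smooth and real; manifolds (and Lie groups) are Hausdorff, second countable, connected and finite-dimensional. \textbf{Definitions.} A differential form $\Theta$ of degree $k\ge 1$ on a manifold $N$ is \emph{$\ell$-nondegenerate} if for every $x\in N$ the only $\ell$-vector $w\in\Lambda^\ell T_xN$ with $\iota_w\Theta_x=0$ is $w=0$; it is \emph{multisymplectic} if it is closed and $1$-nondegenerate. A vector field $Y$ is \emph{locally Hamiltonian} for $\Theta$ if $\iota_Y\Theta$ is closed. For a $t$-dependent vector field $X:\mathbb R\times N\to TN$, $V^X$ denotes the smallest real Lie algebra of vector fields on $N$ containing all $X_t$, $t\in\mathbb R$. A triple $(N,\Theta,X)$ is a \emph{multisymplectic Lie system} if $\Theta$ is multisymplectic, $\dim V^X<\infty$ (so that $X$ is a Lie system), and all elements of $V^X$ are locally Hamiltonian for $\Theta$. Let $G$ be an $r$-dimensional Lie group and $\Phi:G\times N\to N$ an action, with space $V_\Phi$ of fundamental vector fields. The pair $(\Theta,\Phi)$ is a \emph{multisymplectic reduction scheme} if $\Theta$ is an $(r+1)$-nondegenerate multisymplectic form of degree $k\ge r+1$ on $N$, $G$ is unimodular (it has a bi-invariant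 volume form), $\Phi$ is proper and free, and a non-zero $w\in\Lambda^rV_\Phi$ is locally Hamiltonian, i.e. $\mathrm d\,\iota_w\Theta=0$ (equivalently $\mathcal L_w\Theta=0$). \textbf{Theorem.} Let $(N,\Theta,X)$ be a multisymplectic Lie system and let $(\Theta,\Phi)$ be a multisymplectic reduction scheme, with group $G$ and $0\neq w\in\Lambda^rV_\Phi$ as above, such that every $\Phi_g$, $g\in G$, is a symmetry of every element of $V^X$, that is, $(\Phi_g)_*Y=Y$ for all $g\in G$ and $Y\in V^X$. Then the orbit space $N/G$, with the quotient topology, carries a smooth structure of dimension $\dim N-r$ for which the projection $\pi:N\to N/G$ is a submersion, and for it: there is a unique differential form $\widetilde\Theta$ of degree $k-r$ on $N/G$ with $\pi^*\widetilde\Theta=\iota_w\Theta$; there is a unique $t$-dependent vector field $\pi_*X$ on $N/G$ with $T\pi\circ X_t=(\pi_*X)_t\circ\pi$ for all $t\in\mathbb R$; and $(N/G,\widetilde\Theta,\pi_*X)$ is a multisymplectic Lie system. -/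

import Mathlib

open scoped Manifold ContDiff Topology

noncomputable section

namespace Multisymplectic

/-! ### Exterior algebra on a topological vector space -/

section Algebra

variable {T : Type*} [AddCommGroup T] [Module ℝ T] [TopologicalSpace T]

/-- The linear functional on the exterior algebra of `T` induced by an alternating `k`-form `α`:
it sends `v₁ ∧ … ∧ v_k` to `α (v₁, …, v_k)` and vanishes in all degrees other than `k`. -/
def pairing {k : ℕ} (α : T [⋀^Fin k]→L[ℝ] ℝ) : ExteriorAlgebra ℝ T →ₗ[ℝ] ℝ :=
  ExteriorAlgebra.liftAlternating (Pi.single k α.toAlternatingMap)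

theorem pairing_ιMulti {k : ℕ} (α : T [⋀^Fin k]→L[ℝ] ℝ) (v : Fin k → T) :
    pairing α (ExteriorAlgebra.ιMulti ℝ k v) = α v := by
  simp [pairing, ExteriorAlgebra.liftAlternating_apply_ιMulti]

theorem pairing_ιMulti_mul_ιMulti {l m : ℕ} (α : T [⋀^Fin (l + m)]→L[ℝ] ℝ)
    (u : Fin l → T) (v : Fin m → T) :
    pairing α (ExteriorAlgebra.ιMulti ℝ l u * ExteriorAlgebra.ιMulti ℝ m v) =
      α (Fin.append u v) := by
  rw [← pairing_ιMulti]
  congr 1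
  simp only [ExteriorAlgebra.ιMulti_apply]
  rw [← List.prod_append, ← List.ofFn_fin_append]
  congr 2
  funext i
  refine Fin.addCases (fun i => ?_) (fun i => ?_) i <;> simp

theorem continuous_pairing_mul {l m : ℕ} {w : ExteriorAlgebra ℝ T} (hw : w ∈ ⋀[ℝ]^l T)
    (α : T [⋀^Fin (l + m)]→L[ℝ] ℝ) :
    Continuous fun v : Fin m → T =>
      pairing α (w * ExteriorAlgebra.ιMulti ℝ m v) := by
  rw [← ExteriorAlgebra.ιMulti_span_fixedDegree] at hw
  induction hw using Submodule.span_induction with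
  | mem x hx =>
    obtain ⟨u, rfl⟩ := hx
    simp only [pairing_ιMulti_mul_ιMulti]
    refine α.cont.comp (continuous_pi fun i => ?_)
    refine Fin.addCases (fun i => ?_) (fun i => ?_) i
    · simpa using continuous_const
    · simpa using continuous_apply i
  | zero => simpa using continuous_const
  | add x y _ _ hx hy =>
    simp only [add_mul, map_add]
    exact hx.add hy
  | smul a x _ hx =>
    simp only [smul_mul_assoc, map_smul]
    exact hx.const_smul a

/-- The contraction `ι_w α` of an `(l + m)`-form `α` with an `l`-vector `w`, i.e. the `m`-form
`(v₁, …, v_m) ↦ α (w ∧ v₁ ∧ … ∧ v_m)`. -/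
def contract {l m : ℕ} (w : ⋀[ℝ]^l T) (α : T [⋀^Fin (l + m)]→L[ℝ] ℝ) : T [⋀^Fin m]→L[ℝ] ℝ :=
  { ((pairing α).comp (LinearMap.mulLeft ℝ (w : ExteriorAlgebra ℝ T))).compAlternatingMap
      (ExteriorAlgebra.ιMulti ℝ m) with
    cont := continuous_pairing_mul w.2 α }

/-- The inner contraction `ι_v α = α (v, ·, …, ·)` of a `(k + 1)`-form with a vector. -/
def innerContract {k : ℕ} (v : T) (α : T [⋀^Fin (k + 1)]→L[ℝ] ℝ) : T [⋀^Fin k]→L[ℝ] ℝ :=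
  { α.toAlternatingMap.curryLeft v with
    cont := α.cont.comp (Continuous.matrixVecCons continuous_const continuous_id) }

/-- A `k`-form `α` on `T` is `l`-nondegenerate if the only `l`-vector `w` with `ι_w α = 0` is
`w = 0`. The vanishing of `ι_w α` is expressed by `α (w ∧ u) = 0` for all multivectors `u`
(only those `u` of degree `k - l` matter). -/
def IsNondegenerate {k : ℕ} (l : ℕ) (α : T [⋀^Fin k]→L[ℝ] ℝ) : Prop :=
  ∀ w ∈ ⋀[ℝ]^l T, (∀ u : ExteriorAlgebra ℝ T, pairing α (w * u) = 0) → w = 0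

end Algebra

/-! ### Vector fields and differential forms on manifolds modelled on `E` -/

section Manifold

variable (E : Type*) [NormedAddCommGroup E] [NormedSpace ℝ E]
  (M : Type*) [TopologicalSpace M] [ChartedSpace E M]

/-- (Not necessarily smooth) vector fields. -/
abbrev VField : Type _ := (x : M) → TangentSpace 𝓘(ℝ, E) x

/-- (Not necessarily smooth) differential `k`-forms. -/
abbrev DForm (k : ℕ) : Type _ := (x : M) → TangentSpace 𝓘(ℝ, E) x [⋀^Fin k]→L[ℝ] ℝ

variable {E M}
variable {E' : Type*} [NormedAddCommGroup E'] [NormedSpace ℝ E']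
  {M' : Type*} [TopologicalSpace M'] [ChartedSpace E' M']

/-- The pullback `f^* α`. -/
def DForm.pullback {k : ℕ} (f : M → M') (α : DForm E' M' k) : DForm E M k :=
  fun x => (α (f x)).compContinuousLinearMap (mfderiv 𝓘(ℝ, E) 𝓘(ℝ, E') f x)

/-- The expression of a form in the preferred chart at `x₀`, as a form on the model space. -/
def DForm.inChart {k : ℕ} (α : DForm E M k) (x₀ : M) : E → E [⋀^Fin k]→L[ℝ] ℝ :=
  DForm.pullback (E := E) (M := E) (extChartAt 𝓘(ℝ, E) x₀).symm α

/-- A form is smooth if all its chart expressions are. -/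
def DForm.IsSmooth {k : ℕ} (α : DForm E M k) : Prop :=
  ∀ x₀ : M, ContDiffOn ℝ ∞ (α.inChart x₀) (extChartAt 𝓘(ℝ, E) x₀).target

/-- The exterior derivative, computed at `x` in the preferred chart at `x`. -/
def DForm.d {k : ℕ} (α : DForm E M k) : DForm E M (k + 1) := fun x =>
  DForm.pullback (E := E) (E' := E) (M' := E) (extChartAt 𝓘(ℝ, E) x)
    (fun y => extDeriv (E := E) (α.inChart x) y) x

/-- Closed forms. -/
def DForm.IsClosed {k : ℕ} (α : DForm E M k) : Prop := ∀ x, α.d x = 0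

/-- The contraction `ι_Y α` of a form with a vector field. -/
def DForm.contractField {k : ℕ} (Y : VField E M) (α : DForm E M (k + 1)) : DForm E M k :=
  fun x => innerContract (Y x) (α x)

/-- Multisymplectic forms of degree `k + 1`: smooth, closed and one-nondegenerate. -/
structure IsMultisymplecticForm {k : ℕ} (Θ : DForm E M (k + 1)) : Prop where
  smooth : Θ.IsSmooth
  closed : Θ.IsClosed
  nondegenerate : ∀ (x : M) (v : TangentSpace 𝓘(ℝ, E) x), innerContract v (Θ x) = 0 → v = 0

/-- `Y` is locally Hamiltonian with respect to `Θ`: the form `ι_Y Θ` is closed. -/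
def IsLocallyHamiltonian {k : ℕ} (Θ : DForm E M (k + 1)) (Y : VField E M) : Prop :=
  (Θ.contractField Y).IsClosed

variable [IsManifold 𝓘(ℝ, E) ∞ M]

/-- Smooth vector fields. -/
def VField.IsSmooth (Y : VField E M) : Prop :=
  ContMDiff 𝓘(ℝ, E) 𝓘(ℝ, E).tangent ∞
    fun x => (⟨x, Y x⟩ : TangentBundle 𝓘(ℝ, E) M)

/-- Smoothness of a `t`-dependent vector field `X : ℝ × M → TM`. -/
def IsSmoothTimeDependent (X : ℝ → VField E M) : Prop :=
  ContMDiff (𝓘(ℝ, ℝ).prod 𝓘(ℝ, E)) 𝓘(ℝ, E).tangent ∞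
    fun p : ℝ × M => (⟨p.2, X p.1 p.2⟩ : TangentBundle 𝓘(ℝ, E) M)

/-- A linear space of vector fields is a (real) Lie algebra of vector fields if its elements are
smooth and it is closed under the Lie bracket. -/
def IsLieAlgebraOfFields (W : Submodule ℝ (VField E M)) : Prop :=
  (∀ Y ∈ W, Y.IsSmooth) ∧
    ∀ Y ∈ W, ∀ Z ∈ W, VectorField.mlieBracket 𝓘(ℝ, E) Y Z ∈ W

/-- The smallest Lie algebra `V^X` of a `t`-dependent vector field `X`: the smallest real Lie
algebra of vector fields containing all `X_t`. -/
def smallestLieAlgebra (X : ℝ → VField E M) : Submodule ℝ (VField E M) :=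
  sInf {W | IsLieAlgebraOfFields W ∧ ∀ t, X t ∈ W}

/-- A Lie system: a smooth `t`-dependent vector field whose smallest Lie algebra is
finite-dimensional. -/
def IsLieSystem (X : ℝ → VField E M) : Prop :=
  IsSmoothTimeDependent X ∧ FiniteDimensional ℝ (smallestLieAlgebra X)

/-- `(M, Θ, X)` is a multisymplectic Lie system: `Θ` is multisymplectic and `X` is a Lie system
such that `V^X` consists of locally Hamiltonian vector fields. -/
structure IsMultisymplecticLieSystem {k : ℕ} (Θ : DForm E M (k + 1)) (X : ℝ → VField E M) :
    Prop where
  multisymplectic : IsMultisymplecticForm Θ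
  lieSystem : IsLieSystem X
  locallyHamiltonian : ∀ Y ∈ smallestLieAlgebra X, IsLocallyHamiltonian Θ Y

end Manifold

/-! ### Lie group actions -/

section Action

/-- An `r`-dimensional Lie group is unimodular if it has a left-invariant volume form which is also
right-invariant. -/
def IsUnimodularLieGroup (r : ℕ) (G : Type*) [TopologicalSpace G]
    [ChartedSpace (EuclideanSpace ℝ (Fin r)) G] [Group G] : Prop :=
  ∃ η : DForm (EuclideanSpace ℝ (Fin r)) G r, η.IsSmooth ∧ (∀ g, η g ≠ 0) ∧
    (∀ h : G, DForm.pullback (fun g => h * g) η = η) ∧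
    (∀ h : G, DForm.pullback (fun g => g * h) η = η)

variable (E : Type*) [NormedAddCommGroup E] [NormedSpace ℝ E]
  (N : Type*) [TopologicalSpace N] [ChartedSpace E N]
  (F : Type*) [NormedAddCommGroup F] [NormedSpace ℝ F]
  (G : Type*) [TopologicalSpace G] [ChartedSpace F G] [Group G] [MulAction G N]

/-- The map `ξ ↦ ξ_N` sending `ξ ∈ T_e G` to its fundamental vector field
`ξ_N (x) = T_e (g ↦ g • x) ξ`. -/
def fundamentalField : TangentSpace 𝓘(ℝ, F) (1 : G) →ₗ[ℝ] VField E N :=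
  LinearMap.pi fun x =>
    (show TangentSpace 𝓘(ℝ, F) (1 : G) →L[ℝ] TangentSpace 𝓘(ℝ, E) x from
      mfderiv 𝓘(ℝ, F) 𝓘(ℝ, E) (fun g : G => g • x) 1).toLinearMap

/-- The space `V_Φ` of fundamental vector fields of the action. -/
def fundamentalFields : Submodule ℝ (VField E N) :=
  LinearMap.range (fundamentalField E N F G)

variable {E N F G}

/-- The value at `x` of the multivector field on `N` given by `w ∈ Λ^r V_Φ`. -/
def multivectorAt {r : ℕ} (w : ⋀[ℝ]^r (fundamentalFields E N F G)) (x : N) :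
    ⋀[ℝ]^r (TangentSpace 𝓘(ℝ, E) x) :=
  exteriorPower.map r
    ((LinearMap.proj x : VField E N →ₗ[ℝ] TangentSpace 𝓘(ℝ, E) x).comp
      (fundamentalFields E N F G).subtype) w

/-- The contraction `ι_w Θ` with the multivector field given by `w ∈ Λ^r V_Φ`. -/
def DForm.contractMulti {r k : ℕ} (w : ⋀[ℝ]^r (fundamentalFields E N F G))
    (Θ : DForm E N (r + k)) : DForm E N k :=
  fun x => contract (multivectorAt w x) (Θ x)

/-- The maps `Φ_g : x ↦ g • x` are symmetries of the vector field `Y`: `(Φ_g)_* Y = Y`. -/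
def IsInvariantField (G : Type*) [Group G] [MulAction G N] (Y : VField E N) : Prop :=
  ∀ (g : G) (x : N), mfderiv 𝓘(ℝ, E) 𝓘(ℝ, E) (fun y : N => g • y) x (Y x) = Y (g • x)

/-- A multisymplectic reduction scheme: an action on `N` of an `r`-dimensional unimodular Lie group
`G`, a multisymplectic form `Θ`, and a non-zero `w ∈ Λ^r V_Φ`. The multivector field `w` is required
to be locally Hamiltonian, `d ι_w Θ = 0`, which for closed `Θ` is the same as `L_w Θ = 0`. -/
structure IsMultisymplecticReductionScheme {r m : ℕ}
    {E : Type*} [NormedAddCommGroup E] [NormedSpace ℝ E]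
    {N : Type*} [TopologicalSpace N] [ChartedSpace E N]
    {G : Type*} [TopologicalSpace G] [ChartedSpace (EuclideanSpace ℝ (Fin r)) G] [Group G]
    [MulAction G N] (Θ : DForm E N (r + (m + 1)))
    (w : ⋀[ℝ]^r (fundamentalFields E N (EuclideanSpace ℝ (Fin r)) G)) : Prop where
  multisymplectic : IsMultisymplecticForm Θ
  nondegenerate : ∀ x, IsNondegenerate (r + 1) (Θ x)
  unimodular : IsUnimodularLieGroup r G
  smooth_action : ContMDiffSMul 𝓘(ℝ, EuclideanSpace ℝ (Fin r)) 𝓘(ℝ, E) ∞ G N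
  proper_action : ProperSMul G N
  free_action : ∀ (g : G) (x : N), g • x = x → g = 1
  ne_zero : w ≠ 0
  locallyHamiltonian : (Θ.contractMulti w).IsClosed

end Action

/-! ### The orbit space -/

section Quotient

/-- The quotient projection `π : N → N/G`. -/
def orbitProj (G N : Type*) [Group G] [MulAction G N] (x : N) : MulAction.orbitRel.Quotient G N :=
  Quotient.mk _ x

/-- A smooth structure on `N/G`, with the quotient topology, makes it a (Hausdorff, second countable,
connected) manifold such that `π : N → N/G` is a smooth submersion. There is at most one such
smooth structure. -/
structure IsQuotientManifold (E F : Type*) [NormedAddCommGroup E] [NormedSpace ℝ E]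
    [NormedAddCommGroup F] [NormedSpace ℝ F]
    (N : Type*) [TopologicalSpace N] [ChartedSpace E N] (G : Type*) [Group G] [MulAction G N]
    [ChartedSpace F (MulAction.orbitRel.Quotient G N)]
    [IsManifold 𝓘(ℝ, F) ∞ (MulAction.orbitRel.Quotient G N)] : Prop where
  t2 : T2Space (MulAction.orbitRel.Quotient G N)
  secondCountable : SecondCountableTopology (MulAction.orbitRel.Quotient G N)
  connected : ConnectedSpace (MulAction.orbitRel.Quotient G N)
  smooth_proj : ContMDiff 𝓘(ℝ, E) 𝓘(ℝ, F) ∞ (orbitProj G N)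
  submersion : ∀ x : N,
    Function.Surjective (mfderiv 𝓘(ℝ, E) 𝓘(ℝ, F) (orbitProj G N) x)

variable {E F : Type*} [NormedAddCommGroup E] [NormedSpace ℝ E]
  [NormedAddCommGroup F] [NormedSpace ℝ F]
  {M : Type*} [TopologicalSpace M] [ChartedSpace E M]
  {Q : Type*} [TopologicalSpace Q] [ChartedSpace F Q]

/-- The `t`-dependent vector field `X` on `M` projects through `p : M → Q` to `Y`, i.e.
`T p (X_t (x)) = Y_t (p (x))`. -/
def ProjectsTo (p : M → Q) (X : ℝ → VField E M) (Y : ℝ → VField F Q) : Prop :=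
  ∀ (t : ℝ) (x : M), mfderiv 𝓘(ℝ, E) 𝓘(ℝ, F) p x (X t x) = Y t (p x)

end Quotient

end Multisymplectic

end

noncomputable section

namespace Multisymplectic

/-! ### Calculus of differential forms on vector spaces -/

section Calculus

variable {E : Type*} [NormedAddCommGroup E] [NormedSpace ℝ E]
  {E' : Type*} [NormedAddCommGroup E'] [NormedSpace ℝ E']
  {F : Type*} [NormedAddCommGroup F] [NormedSpace ℝ F]

/-! Freeness and properness make `N → N/G` a smooth submersion with local sections. The form `β =
ι_w Θ` is basic for it, hence descends. Every further property of the reduced objects is checked on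
`N`: pullback along the projection `π` is injective, and a form on `N/G` is locally the pullback,
along a local section, of its own pullback, so smoothness and closedness come down.

Orbit space. By freeness the orbit maps are immersions (`injective_mderiv_smul_point`). The inverse
function theorem then splits `N` near a point into group directions and a transversal
(`exists_local_product`). By properness a small enough transversal meets each orbit at most once
(`exists_sliceChart`). These slices give the charts and the local sections of
`exists_quotientManifold`.

Reduced form. `V_Φ` has dimension `r`, so `w` is a non-zero multiple of `ξ₁ ∧ … ∧ ξ_r` for a basis
of fundamental fields, and `β = c Θ(ξ₁, …, ξ_r, ·)` is killed by vectors tangent to the orbits. The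
pullback of the closed form `β` along the action map `G × N → N` is closed and killed by the
`G`-directions, hence constant along them; as `G` is connected, `β` is invariant
(`DForm.IsClosed.val_pullback_smul`). So `β` is basic and equals `π^* Θ'`. If `π_* u` annihilates
`Θ'`, then `ξ₁ ∧ … ∧ ξ_r ∧ u` annihilates `Θ`. By `(r + 1)`-nondegeneracy this wedge is zero, so `u`
is tangent to the orbit and `π_* u = 0`.

Reduced fields. Invariant fields project, and brackets of related fields are related. Thus `π_* V^X`
is a Lie algebra containing all `π_* X_t`, and `V^{π_* X}` lies in it (`smallestLieAlgebra_le_map`):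
it is finite-dimensional and its elements are projections of some `Y ∈ V^X`. Such a `Y` commutes
with each `ξᵢ`, and `L_Y Θ = d ι_Y Θ + ι_Y dΘ = 0`, whence `L_Y β = 0`. Since `dβ = 0`, Cartan's
formula gives `d ι_Y β = 0` (`IsContraction.isClosed_contractField`), and `ι_Y β` is the pullback of
the contraction of `Θ'` with `π_* Y`. -/

theorem minSmoothness_two_le_infty : minSmoothness ℝ 2 ≤ ∞ := by
  rw [minSmoothness_of_isRCLikeNormedField]
  exact WithTop.coe_le_coe.2 le_top

/-- A map into the alternating forms on a finite-dimensional space is smooth if all its evaluations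
are. -/
theorem contDiffAt_of_alternating_apply [FiniteDimensional ℝ E] {k : ℕ} {n : WithTop ℕ∞}
    {f : F → E [⋀^Fin k]→L[ℝ] ℝ} {x : F}
    (h : ∀ v, ContDiffAt ℝ n (fun y => f y v) x) : ContDiffAt ℝ n f x := by
  classical
  let b := Module.finBasis ℝ E
  let ev : (E [⋀^Fin k]→L[ℝ] ℝ) →ₗ[ℝ] ((Fin k → Fin (Module.finrank ℝ E)) → ℝ) :=
    LinearMap.pi fun s =>
      (ContinuousAlternatingMap.apply ℝ E ℝ (fun i => b (s i))).toLinearMap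
  have hev : Function.Injective ev := by
    intro α β hαβ
    apply ContinuousAlternatingMap.toAlternatingMap_injective
    refine Module.Basis.ext_alternating b fun s _ => ?_
    exact congrFun hαβ s
  have : FiniteDimensional ℝ (E [⋀^Fin k]→L[ℝ] ℝ) := FiniteDimensional.of_injective ev hev
  -- The values on tuples of basis vectors determine a form linearly, so `f` is a linear map,
  -- continuous by finite dimension, applied to finitely many evaluations.
  obtain ⟨L, hL⟩ := ev.exists_leftInverse_of_injective (LinearMap.ker_eq_bot.2 hev)
  have hf : f = fun y => L.toContinuousLinearMap (ev (f y)) := by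
    funext y
    exact (LinearMap.congr_fun hL (f y)).symm
  rw [hf]
  refine L.toContinuousLinearMap.contDiff.contDiffAt.comp x (contDiffAt_pi.2 fun s => ?_)
  exact h _

/-- `ContinuousAlternatingMap.curryLeft` as a continuous linear map. -/
abbrev curryLeftL (E : Type*) [NormedAddCommGroup E] [NormedSpace ℝ E] (k : ℕ) :=
  (ContinuousAlternatingMap.curryLeftLI (𝕜 := ℝ) (E := E) (F := ℝ)
    (n := k)).toContinuousLinearMap

theorem contDiff_curryLeft {k : ℕ} {n : WithTop ℕ∞} :
    ContDiff ℝ n fun β : E [⋀^Fin (k + 1)]→L[ℝ] ℝ => β.curryLeft := by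
  refine IsBoundedLinearMap.contDiff (𝕜 := ℝ) ?_
  exact ⟨⟨fun _ _ => rfl, fun _ _ => rfl⟩, 1, one_pos, fun x => by simp⟩

theorem contDiffAt_curryLeft {k : ℕ} {n : WithTop ℕ∞}
    {f : F → E [⋀^Fin (k + 1)]→L[ℝ] ℝ} {v : F → E} {x : F} (hf : ContDiffAt ℝ n f x)
    (hv : ContDiffAt ℝ n v x) : ContDiffAt ℝ n (fun y => (f y).curryLeft (v y)) x :=
  (contDiff_curryLeft.contDiffAt.comp x hf).clm_apply hv

/-- Currying off the first argument lowers the degree by one, so only the bilinear evaluation of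
continuous linear maps has to be differentiated. -/
theorem contDiffAt_alternating_apply {k : ℕ} {n : WithTop ℕ∞}
    {f : F → E [⋀^Fin k]→L[ℝ] ℝ} {v : F → Fin k → E} {x : F} (hf : ContDiffAt ℝ n f x)
    (hv : ∀ i, ContDiffAt ℝ n (fun y => v y i) x) : ContDiffAt ℝ n (fun y => f y (v y)) x := by
  induction k with
  | zero =>
    have : (fun y => f y (v y)) = fun y => ContinuousAlternatingMap.apply ℝ E ℝ 0 (f y) := by
      funext y
      exact congrArg (f y) (Subsingleton.elim _ _)
    rw [this]
    exact (ContinuousAlternatingMap.apply ℝ E ℝ 0).contDiff.contDiffAt.comp x hf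
  | succ k ih =>
    have h := ih (f := fun y => (f y).curryLeft (v y 0)) (v := fun y i => v y i.succ)
      (contDiffAt_curryLeft hf (hv 0)) fun i => hv i.succ
    refine h.congr_of_eventuallyEq (Filter.Eventually.of_forall fun y => ?_)
    simp only [ContinuousAlternatingMap.curryLeft_apply_apply]
    congr 1
    funext i
    refine Fin.cases rfl (fun i => rfl) i

theorem contDiffAt_compContinuousLinearMap [FiniteDimensional ℝ E] {k : ℕ}
    {n : WithTop ℕ∞} {α : F → E' [⋀^Fin k]→L[ℝ] ℝ} {A : F → E →L[ℝ] E'} {x : F}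
    (hα : ContDiffAt ℝ n α x) (hA : ContDiffAt ℝ n A x) :
    ContDiffAt ℝ n (fun y => (α y).compContinuousLinearMap (A y)) x :=
  contDiffAt_of_alternating_apply fun v =>
    contDiffAt_alternating_apply (v := fun y i => A y (v i)) hα fun i => hA.clm_apply
        (contDiffAt_const (c := v i))

/-- Cartan's formula `d ι_Y α + ι_Y d α = L_Y α`. -/
theorem extDeriv_curryLeft_add {k : ℕ} {α : E → E [⋀^Fin (k + 1)]→L[ℝ] ℝ} {Y : E → E} {x : E}
    (hα : DifferentiableAt ℝ α x) (hY : DifferentiableAt ℝ Y x) (v : Fin (k + 1) → E) :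
    extDeriv (fun y => (α y).curryLeft (Y y)) x v + extDeriv α x (Matrix.vecCons (Y x) v) =
      fderiv ℝ α x (Y x) v + ∑ i, α x (Function.update v i (fderiv ℝ Y x (v i))) := by
  have hc : HasFDerivAt (fun y => (α y).curryLeft) ((curryLeftL E k).comp (fderiv ℝ α x)) x :=
    HasFDerivAt.comp (g := curryLeftL E k) x (curryLeftL E k).hasFDerivAt hα.hasFDerivAt
  -- Product rule: one term differentiates `α`, the other differentiates `Y`.
  have h1 : ∀ u w, fderiv ℝ (fun y => (α y).curryLeft (Y y)) x u w =
      fderiv ℝ α x u (Matrix.vecCons (Y x) w) + α x (Matrix.vecCons (fderiv ℝ Y x u) w) := by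
    intro u w
    rw [(hc.clm_apply hY.hasFDerivAt).fderiv]
    simp [curryLeftL, add_comm]
  simp only [extDeriv, ContinuousAlternatingMap.alternatizeUncurryFin_apply, h1]
  rw [Fin.sum_univ_succ (n := k + 1)]
  -- In `dα (Y, v)` the summand at index `0` is the derivative of `α` along `Y`. The later ones have
  -- their sign shifted by one and cancel the terms of `d ι_Y α` that differentiate `α`.
  have h2 : ∀ i : Fin (k + 1), (-1 : ℤ) ^ (i.succ : ℕ) •
      fderiv ℝ α x ((Matrix.vecCons (Y x) v : Fin (k + 2) → E) i.succ)
        (i.succ.removeNth (Matrix.vecCons (Y x) v)) =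
      - ((-1 : ℤ) ^ (i : ℕ) • fderiv ℝ α x (v i) (Matrix.vecCons (Y x) (i.removeNth v))) := by
    intro i
    have : (i.succ.removeNth (Matrix.vecCons (Y x) v) : Fin (k + 1) → E) =
        Matrix.vecCons (Y x) (i.removeNth v) := by
      funext j
      refine Fin.cases rfl (fun j => ?_) j
      simp [Fin.removeNth]
    rw [this]
    simp [pow_succ]
  -- Moving the first argument to slot `i` costs exactly the sign `(-1)^i`.
  have h3 : ∀ i : Fin (k + 1), (-1 : ℤ) ^ (i : ℕ) •
      α x (Matrix.vecCons (fderiv ℝ Y x (v i)) (i.removeNth v)) =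
      α x (Function.update v i (fderiv ℝ Y x (v i))) := by
    intro i
    rw [← Fin.insertNth_removeNth, ContinuousAlternatingMap.map_insertNth]
  simp only [h2, smul_add, h3, Finset.sum_add_distrib, Finset.sum_neg_distrib]
  simp [Fin.removeNth_zero]
  ring

/-- If `α`, `ι_Y α` and `β = ι_{ξ₁ ∧ … ∧ ξ_r} α` are closed at a point and `Y` commutes with the
fields `ξᵢ` there, then `ι_Y β` is closed at this point. -/
theorem extDeriv_curryLeft_contraction {r k : ℕ} {α : E → E [⋀^Fin (r + (k + 1))]→L[ℝ] ℝ}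
    {β : E → E [⋀^Fin (k + 1)]→L[ℝ] ℝ} {ξ : Fin r → E → E} {Y : E → E} {x : E}
    (hα : DifferentiableAt ℝ α x) (hβ : DifferentiableAt ℝ β x)
    (hξ : ∀ i, DifferentiableAt ℝ (ξ i) x) (hY : DifferentiableAt ℝ Y x)
    (hβα : ∀ᶠ y in 𝓝 x, ∀ v, β y v = α y (Fin.append (fun i => ξ i y) v))
    (hcomm : ∀ i, fderiv ℝ (ξ i) x (Y x) = fderiv ℝ Y x (ξ i x))
    (hdα : extDeriv α x = 0) (hdβ : extDeriv β x = 0)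
    (hdYα : extDeriv (n := r + k) (fun y => (α y).curryLeft (Y y)) x = 0) :
    extDeriv (fun y => (β y).curryLeft (Y y)) x = 0 := by
  ext v
  have h1 := extDeriv_curryLeft_add hβ hY v
  have h2 := extDeriv_curryLeft_add (k := r + k) hα hY
    (Fin.append (m := r) (n := k + 1) (fun i => ξ i x) v)
  rw [hdβ] at h1
  rw [hdα, hdYα] at h2
  simp only [ContinuousAlternatingMap.coe_zero, Pi.zero_apply, add_zero] at h1 h2 ⊢
  -- `h2` has `0` as its left side, so the goal becomes the equality of `L_Y β` on `v` with `L_Y α`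
  -- on `(ξ, v)`, both written out by Cartan's formula.
  rw [h1, h2]
  -- Leibniz rule for `β = α (ξ₁, …, ξ_r, ·)`: each `ξᵢ` contributes a term, the constant slots `v`
  -- none. By `hcomm` these terms are the first `r` summands in `L_Y α`; the remaining summands are
  -- those of `L_Y β`.
  have h3 : fderiv ℝ β x (Y x) v =
      fderiv ℝ α x (Y x) (Fin.append (fun i => ξ i x) v) +
        ∑ i : Fin r, α x (Function.update (Fin.append (fun i => ξ i x) v) (Fin.castAdd (k + 1) i)
          (fderiv ℝ (ξ i) x (Y x))) := by
    have e1 : fderiv ℝ β x (Y x) v = fderiv ℝ (fun y => β y v) x (Y x) := by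
      have := ((ContinuousAlternatingMap.apply ℝ E ℝ v).hasFDerivAt.comp x hβ.hasFDerivAt).fderiv
      exact (congrArg (fun L : E →L[ℝ] ℝ => L (Y x)) this).symm
    have e2 : (fun y => β y v) =ᶠ[𝓝 x] fun y => α y (Fin.append (fun i => ξ i y) v) :=
      hβα.mono fun y hy => hy v
    have hg : ∀ i : Fin (r + (k + 1)),
        DifferentiableAt ℝ (fun y => (Fin.append (fun i => ξ i y) v : Fin _ → E) i) x := by
      intro i
      refine Fin.addCases (fun i => ?_) (fun i => ?_) i
      · simpa using hξ i
      · simp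
    rw [e1, e2.fderiv_eq, fderiv_continuousAlternatingMap_apply_apply
      (g := fun i y => (Fin.append (fun i => ξ i y) v : Fin _ → E) i) hα hg, Fin.sum_univ_add]
    congr 1
    convert add_zero _ using 2
    · refine Finset.sum_eq_zero fun i _ => ?_
      refine ContinuousAlternatingMap.map_coord_zero _ (Fin.natAdd r i) ?_
      simp
    · simp
  have h4 := Fin.sum_univ_add (a := r) (b := k + 1) fun i =>
    α x (Function.update (Fin.append (fun i => ξ i x) v) i
      (fderiv ℝ Y x (Fin.append (fun i => ξ i x) v i)))
  rw [h3, add_assoc]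
  refine congrArg₂ (· + ·) rfl (Eq.trans ?_ h4.symm)
  congr 1
  · simp [hcomm]
  · refine Finset.sum_congr rfl fun i _ => ?_
    rw [hβα.self_of_nhds]
    congr 1
    funext j
    refine Fin.addCases (fun j => ?_) (fun j => ?_) j
    · have : Fin.castAdd (k + 1) j ≠ Fin.natAdd r i := by
        intro h; have := congrArg Fin.val h; simp at this; omega
      simp [Function.update_of_ne this]
    · by_cases hj : j = i
      · subst hj; simp
      · have : Fin.natAdd r j ≠ Fin.natAdd r i := by simpa using hj
        simp [Function.update_of_ne this, Function.update_of_ne hj]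

/-- A closed form which is annihilated by a constant vector field is constant in its direction. -/
theorem fderiv_apply_eq_zero_of_extDeriv {k : ℕ} {α : E → E [⋀^Fin k]→L[ℝ] ℝ} {x u : E}
    (hα : DifferentiableAt ℝ α x) (hdα : extDeriv α x = 0)
    (hu : ∀ᶠ y in 𝓝 x, ∀ v : Fin k → E, (∃ i, v i = u) → α y v = 0) :
    fderiv ℝ α x u = 0 := by
  ext v
  have h := congrArg (fun β => β (Matrix.vecCons u v)) hdα
  simp only [extDeriv_apply hα, Fin.sum_univ_succ] at h
  -- Every summand of `dα (u, v)` except the first still has `u` among the arguments of `α`, so it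
  -- differentiates a function vanishing near `x`. The first summand is the derivative of `α` along
  -- `u`.
  have h0 : ∀ i : Fin k, fderiv ℝ (fun y => α y (i.succ.removeNth (Matrix.vecCons u v))) x
      ((Matrix.vecCons u v : Fin (k + 1) → E) i.succ) = 0 := by
    intro i
    have : (fun y => α y (i.succ.removeNth (Matrix.vecCons u v))) =ᶠ[𝓝 x] fun _ => 0 := by
      filter_upwards [hu] with y hy
      refine hy _ ?_
      cases k with
      | zero => exact i.elim0
      | succ k => exact ⟨0, rfl⟩
    rw [this.fderiv_eq]
    simp
  simp only [h0, smul_zero, Finset.sum_const_zero, add_zero] at h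
  have := ((ContinuousAlternatingMap.apply ℝ E ℝ v).hasFDerivAt.comp x hα.hasFDerivAt).fderiv
  have e := congrArg (fun L : E →L[ℝ] ℝ => L u) this
  simp only [Fin.val_zero, pow_zero, one_smul, Fin.removeNth_zero, Matrix.cons_val_zero] at h
  exact e.symm.trans h

/-- Related vector fields have related brackets. -/
theorem fderiv_lieBracket_of_related {h : E → F} {Y Z : E → E} {Y' Z' : F → F} {x : E}
    (hh : ContDiffAt ℝ ∞ h x) (hY : DifferentiableAt ℝ Y x) (hZ : DifferentiableAt ℝ Z x)
    (hY' : DifferentiableAt ℝ Y' (h x)) (hZ' : DifferentiableAt ℝ Z' (h x))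
    (hYY' : ∀ᶠ y in 𝓝 x, fderiv ℝ h y (Y y) = Y' (h y))
    (hZZ' : ∀ᶠ y in 𝓝 x, fderiv ℝ h y (Z y) = Z' (h y)) :
    fderiv ℝ h x (VectorField.lieBracket ℝ Y Z x) = VectorField.lieBracket ℝ Y' Z' (h x) := by
  have hd : DifferentiableAt ℝ h x := hh.differentiableAt (by simp)
  -- Symmetry of the second derivative of `h` lets `Dh [Y, Z]` be computed from the derivatives of
  -- `Dh Z` and `Dh Y`, which are `Z' ∘ h` and `Y' ∘ h` near `x`.
  rw [VectorField.fderiv_apply_lieBracket hh minSmoothness_two_le_infty hZ hY,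
    Filter.EventuallyEq.fderiv_eq hZZ', Filter.EventuallyEq.fderiv_eq hYY',
    fderiv_fun_comp x hZ' hd, fderiv_fun_comp x hY' hd, VectorField.lieBracket]
  simp [hYY'.self_of_nhds, hZZ'.self_of_nhds]

/-- If all maps `H (a, ·)` preserve `Y` at `y`, then `Y` commutes at `y` with the field generated by
`H` in the direction `ζ`. -/
theorem fderiv_generator_eq {H : F × E → E} {a : F} {y : E} {Y : E → E} (ζ : F)
    (hH : ContDiffAt ℝ ∞ H (a, y)) (hHy : H (a, y) = y) (hY : DifferentiableAt ℝ Y y)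
    (hinv : ∀ᶠ b in 𝓝 a, fderiv ℝ H (b, y) (0, Y y) = Y (H (b, y))) :
    fderiv ℝ (fun z => fderiv ℝ H (a, z) (ζ, 0)) y (Y y) =
      fderiv ℝ Y y (fderiv ℝ H (a, y) (ζ, 0)) := by
  have hdH : DifferentiableAt ℝ H (a, y) := hH.differentiableAt (by simp)
  have hddH : DifferentiableAt ℝ (fderiv ℝ H) (a, y) :=
    (hH.fderiv_right (m := ∞) (by simp)).differentiableAt (by simp)
  -- Differentiating the invariance `hinv` in the group variable gives the mixed second derivative
  -- of `H` on one side and `DY` applied to the generator on the other. Differentiating the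
  -- generator along `Y` gives the same mixed derivative in the other order.
  have h1 : HasFDerivAt (fun b : F => fderiv ℝ H (b, y) (0, Y y))
      (((fderiv ℝ (fderiv ℝ H) (a, y)).comp (ContinuousLinearMap.inl ℝ F E)).flip (0, Y y)) a := by
    have : HasFDerivAt (fun b : F => (b, y)) (ContinuousLinearMap.inl ℝ F E) a :=
      hasFDerivAt_prodMk_left a y
    have := HasFDerivAt.comp (g := fderiv ℝ H) a hddH.hasFDerivAt this
    simpa using! this.clm_apply (hasFDerivAt_const ((0, Y y) : F × E) a)
  have h2 : HasFDerivAt (fun z : E => fderiv ℝ H (a, z) (ζ, 0))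
      (((fderiv ℝ (fderiv ℝ H) (a, y)).comp (ContinuousLinearMap.inr ℝ F E)).flip (ζ, 0)) y := by
    have : HasFDerivAt (fun z : E => (a, z)) (ContinuousLinearMap.inr ℝ F E) y :=
      hasFDerivAt_prodMk_right a y
    have := HasFDerivAt.comp (g := fderiv ℝ H) y hddH.hasFDerivAt this
    simpa using! this.clm_apply (hasFDerivAt_const ((ζ, 0) : F × E) y)
  have h3 : HasFDerivAt (fun b : F => Y (H (b, y)))
      ((fderiv ℝ Y y).comp ((fderiv ℝ H (a, y)).comp (ContinuousLinearMap.inl ℝ F E))) a := by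
    have h4 : HasFDerivAt (fun b : F => (b, y)) (ContinuousLinearMap.inl ℝ F E) a :=
      hasFDerivAt_prodMk_left a y
    have h5 := HasFDerivAt.comp (g := H) a hdH.hasFDerivAt h4
    refine HasFDerivAt.comp (g := Y) a ?_ h5
    simpa [hHy] using! hY.hasFDerivAt
  rw [h2.fderiv]
  have h6 := h1.unique (h3.congr_of_eventuallyEq hinv)
  have h7 := congrArg (fun L : F →L[ℝ] E => L ζ) h6
  have hs := hH.isSymmSndFDerivAt minSmoothness_two_le_infty (ζ, 0) (0, Y y)
  simp only [ContinuousLinearMap.flip_apply, ContinuousLinearMap.comp_apply,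
    ContinuousLinearMap.inl_apply, ContinuousLinearMap.inr_apply] at h7 ⊢
  rw [← hs, h7]

end Calculus

/-! ### Derivatives of maps between manifolds, as maps of model spaces -/

section Derivative

variable (E : Type*) [NormedAddCommGroup E] [NormedSpace ℝ E]
  (E' : Type*) [NormedAddCommGroup E'] [NormedSpace ℝ E']
  (E'' : Type*) [NormedAddCommGroup E''] [NormedSpace ℝ E'']
  {M : Type*} [TopologicalSpace M] [ChartedSpace E M]
  {M' : Type*} [TopologicalSpace M'] [ChartedSpace E' M']
  {M'' : Type*} [TopologicalSpace M''] [ChartedSpace E'' M'']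

/-- The derivative of a map of manifolds, as a linear map of the model spaces (to which the tangent
spaces are equal by definition). -/
def mderiv (f : M → M') (x : M) : E →L[ℝ] E' := mfderiv 𝓘(ℝ, E) 𝓘(ℝ, E') f x

variable {E E' E''}

theorem mderiv_comp {g : M' → M''} {f : M → M'} {x : M}
    (hg : MDifferentiableAt 𝓘(ℝ, E') 𝓘(ℝ, E'') g (f x))
    (hf : MDifferentiableAt 𝓘(ℝ, E) 𝓘(ℝ, E') f x) :
    mderiv E E'' (fun y => g (f y)) x = (mderiv E' E'' g (f x)).comp (mderiv E E' f x) :=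
  mfderiv_comp x hg hf

theorem mderiv_congr {f f' : M → M'} {x : M} (h : f =ᶠ[𝓝 x] f') :
    mderiv E E' f x = mderiv E E' f' x :=
  h.mfderiv_eq

theorem mderiv_id (x : M) : mderiv E E (fun y : M => y) x = ContinuousLinearMap.id ℝ E :=
  mfderiv_id

theorem mderiv_eq_fderiv (f : E → E') (x : E) : mderiv E E' f x = fderiv ℝ f x :=
  mfderiv_eq_fderiv

theorem mderiv_const (c : M') (x : M) : mderiv E E' (fun _ : M => c) x = 0 :=
  mfderiv_const

theorem mderiv_left_inverse {f : M → M'} {g : M' → M} {x : M}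
    (hg : MDifferentiableAt 𝓘(ℝ, E') 𝓘(ℝ, E) g (f x))
    (hf : MDifferentiableAt 𝓘(ℝ, E) 𝓘(ℝ, E') f x) (h : ∀ᶠ y in 𝓝 x, g (f y) = y) :
    (mderiv E' E g (f x)).comp (mderiv E E' f x) = ContinuousLinearMap.id ℝ E := by
  rw [← mderiv_comp hg hf, mderiv_congr (f' := fun y => y) h, mderiv_id]

theorem contMDiffAt_extChartAt_symm [IsManifold 𝓘(ℝ, E) ∞ M] {x : M} {y : E}
    (hy : y ∈ (extChartAt 𝓘(ℝ, E) x).target) :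
    ContMDiffAt 𝓘(ℝ, E) 𝓘(ℝ, E) ∞ (extChartAt 𝓘(ℝ, E) x).symm y :=
  (contMDiffOn_extChartAt_symm x).contMDiffAt ((isOpen_extChartAt_target x).mem_nhds hy)

theorem contMDiffAt_extChartAt_of_mem [IsManifold 𝓘(ℝ, E) ∞ M] {x y : M}
    (hy : y ∈ (extChartAt 𝓘(ℝ, E) x).source) :
    ContMDiffAt 𝓘(ℝ, E) 𝓘(ℝ, E) ∞ (extChartAt 𝓘(ℝ, E) x) y :=
  contMDiffAt_extChartAt' (by simpa using hy)

theorem eventually_extChartAt_symm_extChartAt {x y : M}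
    (hy : y ∈ (extChartAt 𝓘(ℝ, E) x).source) :
    ∀ᶠ z in 𝓝 y, (extChartAt 𝓘(ℝ, E) x).symm (extChartAt 𝓘(ℝ, E) x z) = z := by
  filter_upwards [(isOpen_extChartAt_source (I := 𝓘(ℝ, E)) x).mem_nhds hy] with z hz
  exact (extChartAt 𝓘(ℝ, E) x).left_inv hz

theorem eventually_extChartAt_extChartAt_symm {x : M} {y : E}
    (hy : y ∈ (extChartAt 𝓘(ℝ, E) x).target) :
    ∀ᶠ z in 𝓝 y, extChartAt 𝓘(ℝ, E) x ((extChartAt 𝓘(ℝ, E) x).symm z) = z := by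
  filter_upwards [(isOpen_extChartAt_target (I := 𝓘(ℝ, E)) x).mem_nhds hy] with z hz
  exact (extChartAt 𝓘(ℝ, E) x).right_inv hz

theorem mderiv_extChartAt_symm_comp [IsManifold 𝓘(ℝ, E) ∞ M] {x y : M}
    (hy : y ∈ (extChartAt 𝓘(ℝ, E) x).source) :
    (mderiv E E (extChartAt 𝓘(ℝ, E) x).symm (extChartAt 𝓘(ℝ, E) x y)).comp
      (mderiv E E (extChartAt 𝓘(ℝ, E) x) y) = ContinuousLinearMap.id ℝ E :=
  mderiv_left_inverse
    ((contMDiffAt_extChartAt_symm ((extChartAt 𝓘(ℝ, E) x).map_source hy)).mdifferentiableAt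
      (by simp))
    ((contMDiffAt_extChartAt_of_mem hy).mdifferentiableAt (by simp))
    (eventually_extChartAt_symm_extChartAt hy)

theorem mderiv_extChartAt_comp [IsManifold 𝓘(ℝ, E) ∞ M] {x : M} {y : E}
    (hy : y ∈ (extChartAt 𝓘(ℝ, E) x).target) :
    (mderiv E E (extChartAt 𝓘(ℝ, E) x) ((extChartAt 𝓘(ℝ, E) x).symm y)).comp
      (mderiv E E (extChartAt 𝓘(ℝ, E) x).symm y) = ContinuousLinearMap.id ℝ E :=
  mderiv_left_inverse
    ((contMDiffAt_extChartAt_of_mem ((extChartAt 𝓘(ℝ, E) x).map_target hy)).mdifferentiableAt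
      (by simp))
    ((contMDiffAt_extChartAt_symm hy).mdifferentiableAt (by simp))
    (eventually_extChartAt_extChartAt_symm hy)

end Derivative

/-! ### Pullback, smoothness and closedness of forms on manifolds -/

section Forms

variable {E : Type*} [NormedAddCommGroup E] [NormedSpace ℝ E]
  {E' : Type*} [NormedAddCommGroup E'] [NormedSpace ℝ E']
  {E'' : Type*} [NormedAddCommGroup E''] [NormedSpace ℝ E'']
  {M : Type*} [TopologicalSpace M] [ChartedSpace E M]
  {M' : Type*} [TopologicalSpace M'] [ChartedSpace E' M']
  {M'' : Type*} [TopologicalSpace M''] [ChartedSpace E'' M'']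

/-- The value of a form at a point, as a form on the model space. -/
def DForm.val {k : ℕ} (α : DForm E M k) (x : M) : E [⋀^Fin k]→L[ℝ] ℝ := α x

/-- The pullback of a form, pointwise on the model space. -/
theorem DForm.val_pullback {k : ℕ} (f : M → M') (α : DForm E' M' k) (x : M) :
    (DForm.pullback (E := E) f α).val x =
      (α.val (f x)).compContinuousLinearMap (mderiv E E' f x) := rfl

theorem DForm.ext_val {k : ℕ} {α β : DForm E M k} (h : ∀ x, α.val x = β.val x) : α = β :=
  funext h

theorem DForm.val_pullback_congr {k : ℕ} {f f' : M → M'} (α : DForm E' M' k) {x : M}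
    (h : f =ᶠ[𝓝 x] f') :
    (DForm.pullback (E := E) f α).val x = (DForm.pullback (E := E) f' α).val x := by
  rw [DForm.val_pullback, DForm.val_pullback, mderiv_congr h, h.self_of_nhds]

theorem DForm.val_pullback_comp {k : ℕ} {g : M' → M''} {f : M → M'} (α : DForm E'' M'' k) {x : M}
    (hg : MDifferentiableAt 𝓘(ℝ, E') 𝓘(ℝ, E'') g (f x))
    (hf : MDifferentiableAt 𝓘(ℝ, E) 𝓘(ℝ, E') f x) :
    (DForm.pullback (E := E) (fun y => g (f y)) α).val x =
      (DForm.pullback (E := E) f (DForm.pullback (E := E') g α)).val x := by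
  simp only [DForm.val_pullback, mderiv_comp hg hf]
  rfl

theorem eventually_mdifferentiableAt [IsManifold 𝓘(ℝ, E) ∞ M]
    [IsManifold 𝓘(ℝ, E') ∞ M'] {f : M → M'} {x : M}
    (hf : ContMDiffAt 𝓘(ℝ, E) 𝓘(ℝ, E') ∞ f x) :
    ∀ᶠ y in 𝓝 x, MDifferentiableAt 𝓘(ℝ, E) 𝓘(ℝ, E') f y := by
  have : IsManifold 𝓘(ℝ, E) 1 M := IsManifold.of_le (n := ∞) (by exact_mod_cast le_top)
  have : IsManifold 𝓘(ℝ, E') 1 M' := IsManifold.of_le (n := ∞) (by exact_mod_cast le_top)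
  have h1 : ContMDiffAt 𝓘(ℝ, E) 𝓘(ℝ, E') 1 f x := hf.of_le (by exact_mod_cast le_top)
  filter_upwards [(contMDiffAt_iff_contMDiffAt_nhds (by simp)).1 h1] with y hy
  exact hy.mdifferentiableAt (by simp)

/-- The pullback along a map from a vector space, expressed in a chart. -/
theorem DForm.eventually_val_pullback_eq [IsManifold 𝓘(ℝ, E) ∞ M] {k : ℕ} (α : DForm E M k)
    {p : E' → M} {y : E'} {x : M}
    (hp : ContMDiffAt 𝓘(ℝ, E') 𝓘(ℝ, E) ∞ p y) (hx : p y ∈ (extChartAt 𝓘(ℝ, E) x).source) :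
    ∀ᶠ z in 𝓝 y, (DForm.pullback (E := E') p α).val z =
      (α.inChart x (extChartAt 𝓘(ℝ, E) x (p z))).compContinuousLinearMap
        (fderiv ℝ (fun z => extChartAt 𝓘(ℝ, E) x (p z)) z) := by
  have hsrc : ∀ᶠ z in 𝓝 y, p z ∈ (extChartAt 𝓘(ℝ, E) x).source :=
    hp.continuousAt.eventually ((isOpen_extChartAt_source (I := 𝓘(ℝ, E)) x).mem_nhds hx)
  filter_upwards [hsrc.eventually_nhds, eventually_mdifferentiableAt hp] with z hz hpz
  have h1 : p =ᶠ[𝓝 z] fun z => (extChartAt 𝓘(ℝ, E) x).symm (extChartAt 𝓘(ℝ, E) x (p z)) := by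
    filter_upwards [hz] with z hz
    exact ((extChartAt 𝓘(ℝ, E) x).left_inv hz).symm
  have hz := hz.self_of_nhds
  have hφ : MDifferentiableAt 𝓘(ℝ, E) 𝓘(ℝ, E) (extChartAt 𝓘(ℝ, E) x) (p z) :=
    (contMDiffAt_extChartAt_of_mem hz).mdifferentiableAt (by simp)
  rw [DForm.val_pullback_congr α h1, DForm.val_pullback_comp (E' := E) α
    (g := (extChartAt 𝓘(ℝ, E) x).symm) (f := fun z => extChartAt 𝓘(ℝ, E) x (p z))
    ((contMDiffAt_extChartAt_symm ((extChartAt 𝓘(ℝ, E) x).map_source hz)).mdifferentiableAt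
      (by simp)) (hφ.comp z hpz), DForm.val_pullback, mderiv_eq_fderiv]
  rfl

theorem contDiffAt_extChartAt_comp [IsManifold 𝓘(ℝ, E) ∞ M] {p : E' → M} {y : E'} {x : M}
    (hp : ContMDiffAt 𝓘(ℝ, E') 𝓘(ℝ, E) ∞ p y) (hx : p y ∈ (extChartAt 𝓘(ℝ, E) x).source) :
    ContDiffAt ℝ ∞ (fun z => extChartAt 𝓘(ℝ, E) x (p z)) y :=
  ((contMDiffAt_extChartAt_of_mem hx).comp y hp).contDiffAt

theorem DForm.IsSmooth.contDiffAt_inChart {k : ℕ} {α : DForm E M k} (hα : α.IsSmooth) {x : M}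
    {y : E} (hy : y ∈ (extChartAt 𝓘(ℝ, E) x).target) :
    ContDiffAt ℝ ∞ (α.inChart x) y :=
  (hα x).contDiffAt ((isOpen_extChartAt_target x).mem_nhds hy)

theorem DForm.IsSmooth.contDiffAt_pullback [IsManifold 𝓘(ℝ, E) ∞ M] [FiniteDimensional ℝ E']
    {k : ℕ} {α : DForm E M k}
    (hα : α.IsSmooth) {p : E' → M} {y : E'} (hp : ContMDiffAt 𝓘(ℝ, E') 𝓘(ℝ, E) ∞ p y) :
    ContDiffAt ℝ ∞ (DForm.pullback (E := E') p α).val y := by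
  have hx := mem_extChartAt_source (I := 𝓘(ℝ, E)) (p y)
  have hh := contDiffAt_extChartAt_comp hp hx
  refine ContDiffAt.congr_of_eventuallyEq ?_ (α.eventually_val_pullback_eq hp hx)
  refine contDiffAt_compContinuousLinearMap ?_ (hh.fderiv_right (by simp))
  exact ContDiffAt.comp (g := α.inChart (p y)) y
    (hα.contDiffAt_inChart ((extChartAt 𝓘(ℝ, E) (p y)).map_source hx)) hh

theorem DForm.val_d {k : ℕ} (α : DForm E M k) (x : M) :
    α.d.val x = (extDeriv (α.inChart x)
      (extChartAt 𝓘(ℝ, E) x x)).compContinuousLinearMap (mderiv E E (extChartAt 𝓘(ℝ, E) x) x) := rfl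

/-- The chart derivative occurring in `DForm.d` is invertible, with inverse the derivative of the
inverse chart, so it can be stripped off. -/
theorem DForm.isClosed_iff [IsManifold 𝓘(ℝ, E) ∞ M] {k : ℕ} (α : DForm E M k) :
    α.IsClosed ↔ ∀ x, extDeriv (α.inChart x) (extChartAt 𝓘(ℝ, E) x x) = 0 := by
  refine forall_congr' fun x => ?_
  change α.d.val x = 0 ↔ _
  rw [DForm.val_d]
  constructor
  · intro h
    ext v
    have h1 := congrArg (fun β : E [⋀^Fin (k + 1)]→L[ℝ] ℝ =>
      β fun i => mderiv E E (extChartAt 𝓘(ℝ, E) x).symm (extChartAt 𝓘(ℝ, E) x x) (v i)) h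
    have h2 := mderiv_extChartAt_comp (mem_extChartAt_target (I := 𝓘(ℝ, E)) x)
    rw [extChartAt_to_inv] at h2
    have h3 : ∀ v, mderiv E E (extChartAt 𝓘(ℝ, E) x) x
        (mderiv E E (extChartAt 𝓘(ℝ, E) x).symm (extChartAt 𝓘(ℝ, E) x x) v) = v :=
      fun v => congrArg (fun L : E →L[ℝ] E => L v) h2
    have h4 : extDeriv (α.inChart x) (extChartAt 𝓘(ℝ, E) x x) (fun i =>
        mderiv E E (extChartAt 𝓘(ℝ, E) x) x
          (mderiv E E (extChartAt 𝓘(ℝ, E) x).symm (extChartAt 𝓘(ℝ, E) x x) (v i))) = 0 := h1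
    simp only [h3] at h4
    exact h4
  · intro h
    rw [h]
    rfl

/-- The exterior derivative commutes with pullbacks. -/
theorem DForm.IsSmooth.extDeriv_pullback [IsManifold 𝓘(ℝ, E) ∞ M] {k : ℕ} {α : DForm E M k}
    (hα : α.IsSmooth) (hd : α.IsClosed) {p : E' → M} {y : E'}
    (hp : ContMDiffAt 𝓘(ℝ, E') 𝓘(ℝ, E) ∞ p y) :
    extDeriv (DForm.pullback (E := E') p α).val y = 0 := by
  have hx := mem_extChartAt_source (I := 𝓘(ℝ, E)) (p y)
  have hh := contDiffAt_extChartAt_comp hp hx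
  have h1 : (DForm.pullback (E := E') p α).val =ᶠ[𝓝 y] _ := α.eventually_val_pullback_eq hp hx
  have h2 := _root_.extDeriv_pullback (r := ∞) (x := y)
    (f := fun z => extChartAt 𝓘(ℝ, E) (p y) (p z))
    ((hα.contDiffAt_inChart ((extChartAt 𝓘(ℝ, E) (p y)).map_source hx)).differentiableAt
      (by simp)) hh minSmoothness_two_le_infty
  rw [h1.extDeriv_eq, h2, (DForm.isClosed_iff α).1 hd]
  rfl

/-- A form is smooth if it is locally a pullback of smooth forms. -/
theorem DForm.isSmooth_of_local [IsManifold 𝓘(ℝ, E) ∞ M] [IsManifold 𝓘(ℝ, E') ∞ M']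
    [FiniteDimensional ℝ E] {k : ℕ} {α : DForm E M k}
    {β : DForm E' M' k} (hβ : β.IsSmooth)
    (h : ∀ x, ∃ f : M → M', ContMDiffAt 𝓘(ℝ, E) 𝓘(ℝ, E') ∞ f x ∧
      ∀ᶠ y in 𝓝 x, α.val y = (DForm.pullback (E := E) f β).val y) : α.IsSmooth := by
  intro x y hy
  refine ContDiffAt.contDiffWithinAt ?_
  obtain ⟨f, hf, hαf⟩ := h ((extChartAt 𝓘(ℝ, E) x).symm y)
  have hs := contMDiffAt_extChartAt_symm hy
  have hfs : ContMDiffAt 𝓘(ℝ, E) 𝓘(ℝ, E') ∞ (fun z => f ((extChartAt 𝓘(ℝ, E) x).symm z)) y :=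
    hf.comp y hs
  refine (hβ.contDiffAt_pullback hfs).congr_of_eventuallyEq ?_
  filter_upwards [hs.continuousAt.eventually hαf,
    hs.continuousAt.eventually (eventually_mdifferentiableAt hf),
    eventually_mdifferentiableAt hs] with z h1 h2 h3
  rw [DForm.val_pullback_comp β h2 h3]
  change (DForm.pullback (E := E) (M := E) (extChartAt 𝓘(ℝ, E) x).symm α).val z = _
  rw [DForm.val_pullback, h1]
  rfl

/-- A form is closed if it is locally a pullback of smooth closed forms. -/
theorem DForm.isClosed_of_local [IsManifold 𝓘(ℝ, E) ∞ M] [IsManifold 𝓘(ℝ, E') ∞ M']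
    {k : ℕ} {α : DForm E M k}
    {β : DForm E' M' k} (hβ : β.IsSmooth) (hd : β.IsClosed)
    (h : ∀ x, ∃ f : M → M', ContMDiffAt 𝓘(ℝ, E) 𝓘(ℝ, E') ∞ f x ∧
      ∀ᶠ y in 𝓝 x, α.val y = (DForm.pullback (E := E) f β).val y) : α.IsClosed := by
  rw [DForm.isClosed_iff]
  intro x
  obtain ⟨f, hf, hαf⟩ := h x
  have hs := contMDiffAt_extChartAt_symm (mem_extChartAt_target (I := 𝓘(ℝ, E)) x)
  have hx := extChartAt_to_inv (I := 𝓘(ℝ, E)) x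
  rw [← hx] at hf hαf
  have hfs : ContMDiffAt 𝓘(ℝ, E) 𝓘(ℝ, E') ∞ (fun z => f ((extChartAt 𝓘(ℝ, E) x).symm z))
      (extChartAt 𝓘(ℝ, E) x x) := ContMDiffAt.comp _ hf hs
  rw [← hβ.extDeriv_pullback hd hfs]
  refine Filter.EventuallyEq.extDeriv_eq ?_
  filter_upwards [hs.continuousAt.eventually hαf,
    hs.continuousAt.eventually (eventually_mdifferentiableAt hf),
    eventually_mdifferentiableAt hs] with z h1 h2 h3
  rw [DForm.val_pullback_comp β h2 h3]
  change (DForm.pullback (E := E) (M := E) (extChartAt 𝓘(ℝ, E) x).symm α).val z = _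
  rw [DForm.val_pullback, h1]
  rfl

end Forms

/-! ### Smooth actions -/

section SmoothAction

variable {E : Type*} [NormedAddCommGroup E] [NormedSpace ℝ E]
  {F : Type*} [NormedAddCommGroup F] [NormedSpace ℝ F]
  {N : Type*} [TopologicalSpace N] [ChartedSpace E N]

/-- A map with vanishing derivative is locally constant. -/
theorem eventually_eq_of_mderiv_eq_zero [IsManifold 𝓘(ℝ, E) ∞ N] {f : F → N} {a : F}
    (hf : ∀ᶠ b in 𝓝 a, MDifferentiableAt 𝓘(ℝ, F) 𝓘(ℝ, E) f b ∧ mderiv F E f b = 0) :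
    ∀ᶠ b in 𝓝 a, f b = f a := by
  have hc : ContinuousAt f a := hf.self_of_nhds.1.continuousAt
  have hsrc : ∀ᶠ b in 𝓝 a, f b ∈ (extChartAt 𝓘(ℝ, E) (f a)).source :=
    hc.eventually (extChartAt_source_mem_nhds _)
  obtain ⟨ε, hε, hball⟩ := Metric.eventually_nhds_iff_ball.1 (hf.and hsrc)
  have hd : ∀ b ∈ Metric.ball a ε,
      HasFDerivAt (fun b => extChartAt 𝓘(ℝ, E) (f a) (f b)) (0 : F →L[ℝ] E) b := by
    intro b hb
    obtain ⟨⟨h1, h2⟩, h3⟩ := hball b hb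
    have hφ : MDifferentiableAt 𝓘(ℝ, E) 𝓘(ℝ, E) (extChartAt 𝓘(ℝ, E) (f a)) (f b) :=
      (contMDiffAt_extChartAt_of_mem h3).mdifferentiableAt (by simp)
    have h4 : DifferentiableAt ℝ (fun b => extChartAt 𝓘(ℝ, E) (f a) (f b)) b :=
      (hφ.comp b h1).differentiableAt
    have h5 := mderiv_comp hφ h1
    rw [h2, mderiv_eq_fderiv, ContinuousLinearMap.comp_zero] at h5
    rw [← h5]
    exact h4.hasFDerivAt
  filter_upwards [Metric.ball_mem_nhds a hε] with b hb
  have ha : a ∈ Metric.ball a ε := Metric.mem_ball_self hε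
  have := (convex_ball a ε).is_const_of_fderivWithin_eq_zero (𝕜 := ℝ)
    (f := fun b => extChartAt 𝓘(ℝ, E) (f a) (f b))
    (fun b hb => (hd b hb).differentiableAt.differentiableWithinAt)
    (fun b hb => by
      rw [fderivWithin_of_isOpen Metric.isOpen_ball hb, (hd b hb).fderiv]) hb ha
  exact (extChartAt 𝓘(ℝ, E) (f a)).injOn (hball b hb).2 (hball a ha).2 this

variable (F)
variable {G : Type*} [TopologicalSpace G] [ChartedSpace F G] [Group G] [MulAction G N]

section

variable [ContMDiffSMul 𝓘(ℝ, F) 𝓘(ℝ, E) ∞ G N]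

variable (E N G) in
theorem contMDiff_action : ContMDiff (𝓘(ℝ, F).prod 𝓘(ℝ, E)) 𝓘(ℝ, E) ∞
    (fun p : G × N => p.1 • p.2) :=
  ContMDiffSMul.contMDiff_smul

theorem contMDiff_smul_point (x : N) : ContMDiff 𝓘(ℝ, F) 𝓘(ℝ, E) ∞ (fun g : G => g • x) :=
  (contMDiff_action E F N G).comp (contMDiff_id.prodMk contMDiff_const)

theorem contMDiff_smul_left (F : Type*) [NormedAddCommGroup F] [NormedSpace ℝ F] {G : Type*}
    [TopologicalSpace G] [ChartedSpace F G] [Group G] [MulAction G N]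
    [ContMDiffSMul 𝓘(ℝ, F) 𝓘(ℝ, E) ∞ G N] (g : G) : ContMDiff 𝓘(ℝ, E) 𝓘(ℝ, E) ∞
        (fun x : N => g • x) :=
  (contMDiff_action E F N G).comp (contMDiff_const.prodMk contMDiff_id)

end

variable [ContMDiffSMul 𝓘(ℝ, F) 𝓘(ℝ, E) ∞ G N] [FiniteDimensional ℝ F]
  [LieGroup 𝓘(ℝ, F) ∞ G] [IsManifold 𝓘(ℝ, E) ∞ N]

/-- The orbit maps of a free action are immersions. -/
theorem injective_mderiv_smul_point (hfree : ∀ (g : G) (x : N), g • x = x → g = 1) (x : N) :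
    Function.Injective (mderiv F E (fun g : G => g • x) 1) := by
  rw [injective_iff_map_eq_zero]
  intro ξ hξ
  have : CompleteSpace F := FiniteDimensional.complete ℝ F
  have : LieGroup 𝓘(ℝ, F) (minSmoothness ℝ 3) G := LieGroup.of_le (n := ∞) (by
    rw [minSmoothness_of_isRCLikeNormedField]
    exact WithTop.coe_le_coe.2 le_top)
  have : LieGroup 𝓘(ℝ, F) 1 G := LieGroup.of_le (n := ∞) (by exact_mod_cast le_top)
  have : IsManifold 𝓘(ℝ, F) ∞ G :=
    (inferInstance : ContMDiffMul 𝓘(ℝ, F) ∞ G).toIsManifold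
  -- A vector `ξ` killed by the orbit map extends to a left-invariant field that the orbit map kills
  -- everywhere, by equivariance. Its integral curve from `1` therefore fixes `x` for small times,
  -- so by freeness it is constant and its velocity `ξ` is zero.
  let v : G → F := fun g => mulInvariantVectorField (I := 𝓘(ℝ, F)) (G := G) ξ g
  have hv := contMDiffAt_mulInvariantVectorField (I := 𝓘(ℝ, F)) (G := G) ξ (g := 1)
  obtain ⟨γ, hγ0, hγ⟩ := exists_isMIntegralCurveAt_of_contMDiffAt_boundaryless (t₀ := (0 : ℝ))
    (hv.of_le (by
      rw [minSmoothness_of_isRCLikeNormedField]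
      exact WithTop.coe_le_coe.2 (by norm_num)))
  have hφ : ∀ g : G, MDifferentiableAt 𝓘(ℝ, F) 𝓘(ℝ, E) (fun g : G => g • x) g :=
    fun g => (contMDiff_smul_point F x).mdifferentiable (by simp) g
  have hzero : ∀ g : G, mderiv F E (fun g : G => g • x) g (v g) = 0 := by
    intro g
    have hL : MDifferentiableAt 𝓘(ℝ, F) 𝓘(ℝ, F) (fun h : G => g * h) 1 :=
      (contMDiff_mul_left (I := 𝓘(ℝ, F)) (n := ∞) (a := g)).mdifferentiable (by simp) 1
    have e1 := mderiv_comp (E := F) (E' := F) (E'' := E) (g := fun g : G => g • x)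
      (f := fun h : G => g * h) (x := 1) (hφ _) hL
    have e2 := mderiv_comp (E := F) (E' := E) (E'' := E) (g := fun y : N => g • y)
      (f := fun h : G => h • x) (x := 1)
      ((contMDiff_smul_left F g).mdifferentiable (by simp) _) (hφ 1)
    have e3 : mderiv F E (fun h : G => (g * h) • x) 1 = mderiv F E (fun h : G => g • h • x) 1 := by
      congr 1
      funext h
      exact mul_smul g h x
    rw [e1, e2] at e3
    have e4 := congrArg (fun L : F →L[ℝ] E => L ξ) e3
    simp only [ContinuousLinearMap.comp_apply, hξ, map_zero, mul_one] at e4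
    exact e4
  have hconst : ∀ᶠ t in 𝓝 (0 : ℝ), γ t • x = γ 0 • x := by
    refine eventually_eq_of_mderiv_eq_zero (E := E) (f := fun t => γ t • x) ?_
    filter_upwards [hγ] with t ht
    refine ⟨(hφ (γ t)).comp t ht.mdifferentiableAt, ?_⟩
    have e1 := mderiv_comp (E := ℝ) (E' := F) (E'' := E) (g := fun g : G => g • x)
      (f := γ) (x := t) (hφ _) ht.mdifferentiableAt
    have e2 : mderiv ℝ F γ t = (1 : ℝ →L[ℝ] ℝ).smulRight (v (γ t) : F) := ht.mfderiv
    rw [e1, e2]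
    refine ContinuousLinearMap.ext fun s => ?_
    simp [hzero]
  have hγ1 : ∀ᶠ t in 𝓝 (0 : ℝ), γ t = (1 : G) := by
    filter_upwards [hconst] with t ht
    rw [hγ0, one_smul] at ht
    exact hfree _ _ ht
  have e1 : mderiv ℝ F γ 0 = (1 : ℝ →L[ℝ] ℝ).smulRight (v (γ 0) : F) :=
    hγ.self_of_nhds.mfderiv
  rw [mderiv_congr (f' := fun _ => (1 : G)) hγ1, mderiv_const, hγ0] at e1
  have e2 := congrArg (fun L : ℝ →L[ℝ] F => L 1) e1
  have e3 : (v 1 : F) = ξ := by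
    have : mderiv F F (fun h : G => 1 * h) 1 = ContinuousLinearMap.id ℝ F := by
      simp only [one_mul]
      exact mderiv_id 1
    exact congrArg (fun L : F →L[ℝ] F => L ξ) this
  rw [e3] at e2
  have e4 : (0 : F) = (1 : ℝ) • ξ := e2
  simpa using e4.symm

end SmoothAction

/-! ### Slices for proper free actions -/

section Slices

/-- The inverse function theorem, with smoothness of the local inverse on its whole domain. -/
theorem exists_smooth_openPartialHomeomorph {X : Type*} [NormedAddCommGroup X] [NormedSpace ℝ X]
    [FiniteDimensional ℝ X] {Y : Type*} [NormedAddCommGroup Y] [NormedSpace ℝ Y]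
    {f : X → Y} {a : X} (hf : ∀ᶠ z in 𝓝 a, ContDiffAt ℝ ∞ f z)
    (hbij : Function.Bijective (fderiv ℝ f a)) :
    ∃ e : OpenPartialHomeomorph X Y, a ∈ e.source ∧ (∀ z, e z = f z) ∧
      ∀ y ∈ e.target, ContDiffAt ℝ ∞ e.symm y := by
  have : CompleteSpace X := FiniteDimensional.complete ℝ X
  let A : X ≃L[ℝ] Y :=
    (LinearEquiv.ofBijective (fderiv ℝ f a).toLinearMap hbij).toContinuousLinearEquiv
  have hA : (A : X →L[ℝ] Y) = fderiv ℝ f a := by ext v; rfl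
  have hd := hf.self_of_nhds.differentiableAt (by simp)
  have hA' : HasFDerivAt f (A : X →L[ℝ] Y) a := hA ▸ hd.hasFDerivAt
  have hc : ContinuousAt (fderiv ℝ f) a :=
    (hf.self_of_nhds.fderiv_right (m := ∞) (by simp)).continuousAt
  -- Invertibility of the derivative is an open condition; restricting to the set `V` where it holds
  -- makes the inverse smooth at every point of its domain and not just at the image of `a`.
  have hinv : ∀ᶠ z in 𝓝 a, fderiv ℝ f z ∈ Set.range ((↑) : (X ≃L[ℝ] Y) → X →L[ℝ] Y) :=
    hc.eventually (ContinuousLinearEquiv.isOpen.mem_nhds ⟨A, hA⟩)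
  obtain ⟨V, hV, hVo, haV⟩ := mem_nhds_iff.1 (hf.and hinv)
  let e := (hf.self_of_nhds.toOpenPartialHomeomorph f hA' (by simp)).restrOpen V hVo
  refine ⟨e, ⟨hf.self_of_nhds.mem_toOpenPartialHomeomorph_source hA' (by simp), haV⟩,
    fun z => rfl, fun y hy => ?_⟩
  have hz : e.symm y ∈ V := (e.map_target hy).2
  obtain ⟨h1, B, hB⟩ := hV hz
  refine e.contDiffAt_symm (f₀' := B) hy ?_ h1
  rw [hB]
  exact (h1.differentiableAt (by simp)).hasFDerivAt

/-- `L` identifies `S` with a complement of the range of `D`. For `D` the derivative of an orbit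
map, `L` supplies the directions of a slice. -/
theorem exists_complement {E F S : Type*} [NormedAddCommGroup E] [NormedSpace ℝ E]
    [FiniteDimensional ℝ E] [NormedAddCommGroup F] [NormedSpace ℝ F] [FiniteDimensional ℝ F]
    [NormedAddCommGroup S] [NormedSpace ℝ S] [FiniteDimensional ℝ S]
    (hdim : Module.finrank ℝ F + Module.finrank ℝ S = Module.finrank ℝ E)
    (D : F →L[ℝ] E) (hD : Function.Injective D) :
    ∃ L : S →L[ℝ] E, Function.Bijective (D.coprod L) := by
  obtain ⟨C, hC⟩ := D.range.exists_isCompl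
  have h1 := Submodule.finrank_add_eq_of_isCompl hC
  have h2 : Module.finrank ℝ D.range = Module.finrank ℝ F := LinearMap.finrank_range_of_inj hD
  have h3 : Module.finrank ℝ S = Module.finrank ℝ C := by omega
  let ι := LinearEquiv.ofFinrankEq S C h3
  let L : S →L[ℝ] E := (C.subtype.comp ι.toLinearMap).toContinuousLinearMap
  have hinj : Function.Injective (D.coprod L) := by
    rw [injective_iff_map_eq_zero]
    rintro ⟨a, s⟩ h
    have h4 : D a + ι s = 0 := h
    have h5 : D a ∈ C := by
      rw [eq_neg_of_add_eq_zero_left h4]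
      exact C.neg_mem (ι s).2
    have h6 : D a = 0 := (Submodule.disjoint_def.1 hC.disjoint) _ ⟨a, rfl⟩ h5
    have h7 : ι s = 0 := by
      rw [h6, zero_add] at h4
      exact Subtype.ext h4
    have h8 : a = 0 := hD (h6.trans (map_zero D).symm)
    have h9 : s = 0 := by simpa using h7
    rw [h8, h9]
    rfl
  refine ⟨L, hinj, ?_⟩
  refine (LinearMap.injective_iff_surjective_of_finrank_eq_finrank
    (f := (D.coprod L).toLinearMap) ?_).1 hinj
  rw [Module.finrank_prod, hdim]

variable {E : Type*} [NormedAddCommGroup E] [NormedSpace ℝ E] [FiniteDimensional ℝ E]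
  (F : Type*) [NormedAddCommGroup F] [NormedSpace ℝ F] [FiniteDimensional ℝ F]
  (S : Type*) [NormedAddCommGroup S] [NormedSpace ℝ S] [FiniteDimensional ℝ S]
  {N : Type*} [TopologicalSpace N] [ChartedSpace E N] [IsManifold 𝓘(ℝ, E) ∞ N]
  {G : Type*} [TopologicalSpace G] [ChartedSpace F G] [Group G] [LieGroup 𝓘(ℝ, F) ∞ G]
  [MulAction G N] [ContMDiffSMul 𝓘(ℝ, F) 𝓘(ℝ, E) ∞ G N]

/-- Near a point the action of group elements close to the identity on a transversal is a
product. -/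
theorem exists_local_product
    (hdim : Module.finrank ℝ F + Module.finrank ℝ S = Module.finrank ℝ E)
    (hfree : ∀ (g : G) (x : N), g • x = x → g = 1) (x : N) :
    ∃ (O : Set N) (U : Set S) (A : Set G) (p : N → G) (q : N → S) (σ : S → N),
      IsOpen O ∧ IsOpen U ∧ (0 : S) ∈ U ∧ IsOpen A ∧ (1 : G) ∈ A ∧ σ 0 = x ∧
      (∀ y ∈ O, p y • σ (q y) = y) ∧
      (∀ y ∈ O, ContMDiffAt 𝓘(ℝ, E) 𝓘(ℝ, S) ∞ q y) ∧
      (∀ s ∈ U, ContMDiffAt 𝓘(ℝ, S) 𝓘(ℝ, E) ∞ σ s) ∧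
      (∀ g ∈ A, ∀ s ∈ U, g • σ s ∈ O ∧ q (g • σ s) = s) := by
  have : IsManifold 𝓘(ℝ, F) ∞ G := (inferInstance : ContMDiffMul 𝓘(ℝ, F) ∞ G).toIsManifold
  set φ := extChartAt 𝓘(ℝ, E) x with hφ
  set χ := extChartAt 𝓘(ℝ, F) (1 : G) with hχ
  have hxφ : x ∈ φ.source := mem_extChartAt_source x
  have h1χ : (1 : G) ∈ χ.source := mem_extChartAt_source 1
  have hχ1 : χ.symm (χ 1) = 1 := χ.left_inv h1χ
  -- the orbit map in charts
  let f₀ : F → E := fun a => φ (χ.symm a • x)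
  have hχs : ∀ a ∈ χ.target, ContMDiffAt 𝓘(ℝ, F) 𝓘(ℝ, F) ∞ χ.symm a :=
    fun a ha => contMDiffAt_extChartAt_symm ha
  have h1t : χ 1 ∈ χ.target := χ.map_source h1χ
  have hD : Function.Injective (fderiv ℝ f₀ (χ 1)) := by
    have e1 : fderiv ℝ f₀ (χ 1) = (mderiv E E φ x).comp
        ((mderiv F E (fun g : G => g • x) 1).comp (mderiv F F χ.symm (χ 1))) := by
      have d1 : MDifferentiableAt 𝓘(ℝ, F) 𝓘(ℝ, F) χ.symm (χ 1) :=
        (hχs _ h1t).mdifferentiableAt (by simp)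
      have d2 : MDifferentiableAt 𝓘(ℝ, F) 𝓘(ℝ, E) (fun g : G => g • x) (χ.symm (χ 1)) :=
        (contMDiff_smul_point F x).mdifferentiable (by simp) _
      have d3 : MDifferentiableAt 𝓘(ℝ, E) 𝓘(ℝ, E) φ (χ.symm (χ 1) • x) := by
        rw [hχ1, one_smul]
        exact (contMDiffAt_extChartAt_of_mem hxφ).mdifferentiableAt (by simp)
      have e := mderiv_comp (E := F) (E' := E) (E'' := E) (g := φ)
        (f := fun a => χ.symm a • x) (x := χ 1) d3 (d2.comp _ d1)
      rw [mderiv_comp (E := F) (E' := F) (E'' := E) (g := fun g : G => g • x) d2 d1, hχ1, one_smul,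
        mderiv_eq_fderiv] at e
      exact e
    have i1 : Function.Injective (mderiv E E φ x) := by
      refine Function.LeftInverse.injective (g := mderiv E E φ.symm (φ x)) fun v => ?_
      exact congrArg (fun L : E →L[ℝ] E => L v) (mderiv_extChartAt_symm_comp hxφ)
    have i2 : Function.Injective (mderiv F F χ.symm (χ 1)) := by
      refine Function.LeftInverse.injective (g := mderiv F F χ (χ.symm (χ 1))) fun v => ?_
      exact congrArg (fun L : F →L[ℝ] F => L v) (mderiv_extChartAt_comp h1t)
    rw [e1]
    exact i1.comp ((injective_mderiv_smul_point F hfree x).comp i2)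
  obtain ⟨L, hL⟩ := exists_complement (S := S) hdim _ hD
  -- The slice is an affine piece in the chart at `x`. In charts the map `(g, s) ↦ g • σ s` has
  -- derivative `D ⊕ L` at `(1, 0)`, which is bijective, so the inverse function theorem applies.
  let σ : S → N := fun s => φ.symm (φ x + L s)
  let ψ : F × S → N := fun z => χ.symm z.1 • σ z.2
  have hσ0 : σ 0 = x := by simp [σ, φ.left_inv hxφ]
  have hψ0 : ψ (χ 1, 0) = x := by simp only [ψ, hχ1, hσ0, one_smul]
  have hσ : ∀ s, φ x + L s ∈ φ.target → ContMDiffAt 𝓘(ℝ, S) 𝓘(ℝ, E) ∞ σ s := by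
    intro s hs
    refine ContMDiffAt.comp (g := φ.symm) s (contMDiffAt_extChartAt_symm hs) ?_
    exact (contDiffAt_const.add L.contDiff.contDiffAt).contMDiffAt
  have hψ : ∀ z : F × S, z.1 ∈ χ.target → φ x + L z.2 ∈ φ.target →
      ContMDiffAt 𝓘(ℝ, F × S) 𝓘(ℝ, E) ∞ ψ z := by
    intro z h1 h2
    have c1 : ContMDiffAt 𝓘(ℝ, F × S) 𝓘(ℝ, F) ∞ (fun z : F × S => χ.symm z.1) z :=
      ContMDiffAt.comp (g := χ.symm) z (hχs _ h1) contDiffAt_fst.contMDiffAt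
    have c2 : ContMDiffAt 𝓘(ℝ, F × S) 𝓘(ℝ, E) ∞ (fun z : F × S => σ z.2) z :=
      ContMDiffAt.comp (g := σ) z (hσ _ h2) contDiffAt_snd.contMDiffAt
    exact ((contMDiff_action E F N G) (χ.symm z.1, σ z.2)).comp z (c1.prodMk c2)
  have hgood : ∀ᶠ z in 𝓝 ((χ 1, 0) : F × S), z.1 ∈ χ.target ∧ φ x + L z.2 ∈ φ.target ∧
      ψ z ∈ φ.source := by
    have g1 : ∀ᶠ z in 𝓝 ((χ 1, 0) : F × S), z.1 ∈ χ.target :=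
      continuousAt_fst.eventually ((isOpen_extChartAt_target (I := 𝓘(ℝ, F)) (1 : G)).mem_nhds h1t)
    have hcont : Continuous fun z : F × S => φ x + L z.2 := by fun_prop
    have hx0 : φ x + L ((χ 1, 0) : F × S).2 ∈ φ.target := by
      simpa using φ.map_source hxφ
    have g2 : ∀ᶠ z in 𝓝 ((χ 1, 0) : F × S), φ x + L z.2 ∈ φ.target :=
      hcont.continuousAt.eventually ((isOpen_extChartAt_target (I := 𝓘(ℝ, E)) x).mem_nhds hx0)
    have g3 : ∀ᶠ z in 𝓝 ((χ 1, 0) : F × S), ψ z ∈ φ.source := by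
      refine (hψ (χ 1, 0) h1t hx0).continuousAt.eventually ?_
      rw [hψ0]
      exact extChartAt_source_mem_nhds x
    filter_upwards [g1, g2, g3] with z h1 h2 h3 using ⟨h1, h2, h3⟩
  let f : F × S → E := fun z => φ (ψ z)
  have hf : ∀ z : F × S, (z.1 ∈ χ.target ∧ φ x + L z.2 ∈ φ.target ∧ ψ z ∈ φ.source) →
      ContDiffAt ℝ ∞ f z := fun z hz =>
    (ContMDiffAt.comp (g := φ) z (contMDiffAt_extChartAt_of_mem hz.2.2)
      (hψ z hz.1 hz.2.1)).contDiffAt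
  have hfd : DifferentiableAt ℝ f (χ 1, 0) := (hf _ hgood.self_of_nhds).differentiableAt (by simp)
  have hderiv : fderiv ℝ f (χ 1, 0) = (fderiv ℝ f₀ (χ 1)).coprod L := by
    have e1 : (fderiv ℝ f (χ 1, 0)).comp (ContinuousLinearMap.inl ℝ F S) = fderiv ℝ f₀ (χ 1) := by
      have hl : HasFDerivAt (fun a : F => (a, (0 : S))) (ContinuousLinearMap.inl ℝ F S) (χ 1) :=
        hasFDerivAt_prodMk_left _ _
      have := HasFDerivAt.comp (g := f) (χ 1) hfd.hasFDerivAt hl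
      rw [← this.fderiv]
      congr 1
      funext a
      simp only [f, f₀, ψ, Function.comp_apply, hσ0]
    have e2 : (fderiv ℝ f (χ 1, 0)).comp (ContinuousLinearMap.inr ℝ F S) = L := by
      have hr : HasFDerivAt (fun s : S => (χ 1, s)) (ContinuousLinearMap.inr ℝ F S) 0 :=
        hasFDerivAt_prodMk_right _ _
      have := HasFDerivAt.comp (g := f) (0 : S) hfd.hasFDerivAt hr
      rw [← this.fderiv]
      have hL' : HasFDerivAt (fun s => φ x + L s) L (0 : S) := L.hasFDerivAt.const_add _
      rw [← hL'.fderiv]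
      refine Filter.EventuallyEq.fderiv_eq ?_
      have hcont : Continuous fun s : S => φ x + L s := by fun_prop
      have hx0 : φ x + L (0 : S) ∈ φ.target := by simpa using φ.map_source hxφ
      filter_upwards [hcont.continuousAt.eventually
        ((isOpen_extChartAt_target (I := 𝓘(ℝ, E)) x).mem_nhds hx0)] with s hs
      simp only [f, ψ, σ, Function.comp_apply, hχ1, one_smul]
      exact φ.right_inv hs
    rw [← e1, ← e2]
    ext v <;> simp
  obtain ⟨e, hae, hef, hesymm⟩ := exists_smooth_openPartialHomeomorph (f := f) (a := (χ 1, 0))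
    (hgood.mono hf) (by rw [hderiv]; exact hL)
  -- Shrinking to a box `A₀ ×ˢ U` lets the group coordinate and the slice coordinate be restricted
  -- independently; `O` is the set of points whose two coordinates lie in this box.
  obtain ⟨V, hV, hVo, haV⟩ := mem_nhds_iff.1 (hgood.and (e.open_source.mem_nhds hae))
  obtain ⟨A₀, U, hA₀, hU, ha₀, h0U, hAU⟩ := isOpen_prod_iff.1 hVo _ _ haV
  have hO₁ := e.isOpen_inter_preimage_symm (hA₀.prod hU)
  refine ⟨φ.source ∩ φ ⁻¹' (e.target ∩ e.symm ⁻¹' (A₀ ×ˢ U)), U, χ.source ∩ χ ⁻¹' A₀,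
    fun y => χ.symm (e.symm (φ y)).1, fun y => (e.symm (φ y)).2, σ,
    (continuousOn_extChartAt (I := 𝓘(ℝ, E)) x).isOpen_inter_preimage
      (isOpen_extChartAt_source (I := 𝓘(ℝ, E)) x) hO₁, hU, h0U,
    (continuousOn_extChartAt (I := 𝓘(ℝ, F)) (1 : G)).isOpen_inter_preimage
      (isOpen_extChartAt_source (I := 𝓘(ℝ, F)) (1 : G)) hA₀, ⟨h1χ, ha₀⟩, hσ0, ?_, ?_, ?_, ?_⟩
  · rintro y ⟨hy, hyt, hyA⟩
    have h1 := hV (hAU hyA)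
    have h2 : φ (ψ (e.symm (φ y))) = φ y := (hef _).symm.trans (e.right_inv hyt)
    exact φ.injOn h1.1.2.2 hy h2
  · rintro y ⟨hy, hyt, hyA⟩
    have h1 : ContMDiffAt 𝓘(ℝ, E) 𝓘(ℝ, F × S) ∞ (fun y => e.symm (φ y)) y :=
      ContMDiffAt.comp (g := e.symm) y (hesymm _ hyt).contMDiffAt
        (contMDiffAt_extChartAt_of_mem hy)
    exact ContMDiffAt.comp (g := fun z : F × S => z.2) y contDiffAt_snd.contMDiffAt h1
  · intro s hs
    exact hσ s (hV (hAU (Set.mk_mem_prod ha₀ hs))).1.2.1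
  · rintro g ⟨hg, hgA⟩ s hs
    have h1 := hV (hAU (Set.mk_mem_prod hgA hs))
    have h2 : g • σ s = ψ (χ g, s) := by simp only [ψ, χ.left_inv hg]
    have h3 : φ (g • σ s) = e (χ g, s) := by rw [h2, hef]
    have h4 : e.symm (φ (g • σ s)) = (χ g, s) := by rw [h3, e.left_inv h1.2]
    refine ⟨⟨h2 ▸ h1.1.2.2, ?_, ?_⟩, ?_⟩
    · rw [h3]; exact e.map_source h1.2
    · rw [Set.mem_preimage, h4]; exact ⟨hgA, hs⟩
    · exact congrArg Prod.snd h4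

end Slices

/-! ### The quotient manifold -/

section Orbits

variable {G N : Type*} [Group G] [MulAction G N]

theorem orbitProj_eq_iff {x y : N} : orbitProj G N x = orbitProj G N y ↔ ∃ g : G, g • y = x := by
  rw [orbitProj, orbitProj, Quotient.eq, MulAction.orbitRel_apply, MulAction.mem_orbit_iff]

theorem orbitProj_smul (g : G) (x : N) : orbitProj G N (g • x) = orbitProj G N x :=
  orbitProj_eq_iff.2 ⟨g, rfl⟩

theorem orbitProj_out (p : MulAction.orbitRel.Quotient G N) :
    orbitProj G N (Quotient.out p) = p :=
  Quotient.out_eq p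

theorem surjective_orbitProj : Function.Surjective (orbitProj G N) :=
  fun p => ⟨_, orbitProj_out p⟩

theorem exists_smul_out (x : N) : ∃ g : G, g • Quotient.out (orbitProj G N x) = x :=
  orbitProj_eq_iff.1 (orbitProj_out _).symm

theorem isOpenQuotientMap_orbitProj [TopologicalSpace N] [ContinuousConstSMul G N] :
    IsOpenQuotientMap (orbitProj G N) :=
  MulAction.isOpenQuotientMap_quotientMk

end Orbits

section QuotientManifold

/-- An invariant open set of `N` with a submersion `q` to `S` whose fibres are single orbits, and a
smooth section of `q`. -/
structure SliceChart (E S N G : Type*) [NormedAddCommGroup E] [NormedSpace ℝ E]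
    [NormedAddCommGroup S] [NormedSpace ℝ S] [TopologicalSpace N] [ChartedSpace E N]
    [Group G] [MulAction G N] where
  /-- the invariant open set -/
  dom : Set N
  /-- the image of the submersion -/
  img : Set S
  /-- the submersion -/
  proj : N → S
  /-- the section -/
  sec : S → N
  isOpen_dom : IsOpen dom
  isOpen_img : IsOpen img
  proj_mem : ∀ y ∈ dom, proj y ∈ img
  sec_mem : ∀ s ∈ img, sec s ∈ dom
  proj_sec : ∀ s ∈ img, proj (sec s) = s
  smul_mem : ∀ (g : G), ∀ y ∈ dom, g • y ∈ dom
  proj_smul : ∀ (g : G), ∀ y ∈ dom, proj (g • y) = proj y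
  exists_smul : ∀ y ∈ dom, ∃ g : G, g • sec (proj y) = y
  contMDiffAt_proj : ∀ y ∈ dom, ContMDiffAt 𝓘(ℝ, E) 𝓘(ℝ, S) ∞ proj y
  contMDiffAt_sec : ∀ s ∈ img, ContMDiffAt 𝓘(ℝ, S) 𝓘(ℝ, E) ∞ sec s

variable {E : Type*} [NormedAddCommGroup E] [NormedSpace ℝ E]
  (F : Type*) [NormedAddCommGroup F] [NormedSpace ℝ F]
  (S : Type*) [NormedAddCommGroup S] [NormedSpace ℝ S]
  {N : Type*} [TopologicalSpace N] [ChartedSpace E N]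
  {G : Type*} [Group G] [MulAction G N]

section

variable [TopologicalSpace G]

/-- In a proper free action, a group element moving a point near `x` to a point near `x` is close to
the identity. -/
theorem eventually_mem_of_smul_near [ProperSMul G N]
    (hfree : ∀ (g : G) (x : N), g • x = x → g = 1) (x : N) {A : Set G} (hA : A ∈ 𝓝 (1 : G)) :
    ∃ V ∈ 𝓝 x, ∀ (g : G), ∀ y ∈ V, g • y ∈ V → g ∈ A := by
  let f : G × N → N × N := fun gx => (gx.1 • gx.2, gx.2)
  have hp : IsProperMap f := ProperSMul.isProperMap_smul_pair
  have hinj : Function.Injective f := by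
    rintro ⟨g, y⟩ ⟨h, z⟩ hgh
    obtain ⟨h1, h2⟩ := Prod.mk.inj hgh
    simp only at h1 h2
    subst h2
    have : h⁻¹ * g = 1 := hfree _ y (by rw [mul_smul, h1, inv_smul_smul])
    rw [eq_of_inv_mul_eq_one this]
  -- By freeness and properness `(g, y) ↦ (g • y, y)` is a closed embedding, so the neighbourhood `A
  -- ×ˢ univ` of `(1, x)` contains the preimage of a neighbourhood of `(x, x)`.
  have hemb := Topology.IsClosedEmbedding.of_continuous_injective_isClosedMap hp.continuous hinj
    hp.isClosedMap
  have h1 : A ×ˢ (Set.univ : Set N) ∈ 𝓝 ((1 : G), x) := prod_mem_nhds hA Filter.univ_mem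
  rw [hemb.isInducing.nhds_eq_comap] at h1
  obtain ⟨W, hW, hWA⟩ := h1
  have h2 : f (1, x) = (x, x) := by simp [f]
  rw [h2, nhds_prod_eq, Filter.mem_prod_self_iff] at hW
  obtain ⟨V, hV, hVW⟩ := hW
  exact ⟨V, hV, fun g y hy hgy => (hWA (show (g, y) ∈ f ⁻¹' W from hVW ⟨hgy, hy⟩)).1⟩

/-- A group element joining two points of a small slice is close to `1` by properness, and the local
product structure then makes the points equal. Hence the slice coordinate is constant on orbits and
extends to the saturation `W` of the slice neighbourhood. -/
theorem exists_sliceChart [FiniteDimensional ℝ E] [FiniteDimensional ℝ F] [FiniteDimensional ℝ S]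
    [IsManifold 𝓘(ℝ, E) ∞ N] [ChartedSpace F G] [LieGroup 𝓘(ℝ, F) ∞ G]
    [ContMDiffSMul 𝓘(ℝ, F) 𝓘(ℝ, E) ∞ G N] [ProperSMul G N]
    (hdim : Module.finrank ℝ F + Module.finrank ℝ S = Module.finrank ℝ E)
    (hfree : ∀ (g : G) (x : N), g • x = x → g = 1) (x : N) :
    ∃ c : SliceChart E S N G, x ∈ c.dom := by
  classical
  obtain ⟨O, U, A, p, q, σ, hO, hU, h0U, hA, h1A, hσ0, hpq, hq, hσ, hA'⟩ :=
    exists_local_product F S hdim hfree x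
  obtain ⟨V, hV, hVA⟩ := eventually_mem_of_smul_near hfree x (hA.mem_nhds h1A)
  have hσc : ∀ᶠ s in 𝓝 (0 : S), σ s ∈ V :=
    (hσ 0 h0U).continuousAt.eventually (by rw [hσ0]; exact hV)
  obtain ⟨U', hU'sub, hU', h0U'⟩ := mem_nhds_iff.1 ((hU.eventually_mem h0U).and hσc)
  have hsep : ∀ (g : G), ∀ s ∈ U', ∀ s' ∈ U', g • σ s = σ s' → s = s' := by
    intro g s hs s' hs' hg
    have hgA : g ∈ A := hVA g _ (hU'sub hs).2 (hg ▸ (hU'sub hs').2)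
    have h1 := (hA' g hgA s (hU'sub hs).1).2
    have h2 := (hA' 1 h1A s' (hU'sub hs').1).2
    rw [one_smul] at h2
    rw [← h1, hg, h2]
  let O' : Set N := O ∩ q ⁻¹' U'
  have hO' : IsOpen O' :=
    ContinuousOn.isOpen_inter_preimage
      (fun y hy => (hq y hy).continuousAt.continuousWithinAt) hO hU'
  let W : Set N := {y | ∃ g : G, g • y ∈ O'}
  -- A point is moved into `O'` by some group element and its slice coordinate is read there; the
  -- value `0` off `W` is arbitrary. `hQ` shows that the choice of the group element is immaterial.
  let Q : N → S := fun y => if h : ∃ g : G, g • y ∈ O' then q (h.choose • y) else 0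
  have hQ : ∀ (g : G) (y : N), g • y ∈ O' → Q y = q (g • y) := by
    intro g y hg
    have h : ∃ g : G, g • y ∈ O' := ⟨g, hg⟩
    have hQy : Q y = q (h.choose • y) := dif_pos h
    rw [hQy]
    have h1 := hpq _ h.choose_spec.1
    have h2 := hpq _ hg.1
    -- With `h` the chosen element, this product carries the slice point of `h • y` to `h • y`, then
    -- to `y`, to `g • y`, and finally to the slice point of `g • y`.
    refine hsep ((p (g • y))⁻¹ * g * (h.choose)⁻¹ * p (h.choose • y)) _ h.choose_spec.2 _ hg.2 ?_
    rw [mul_smul, h1, mul_smul, inv_smul_smul, mul_smul, inv_smul_eq_iff, h2]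
  have hσO : ∀ s ∈ U', (1 : G) • σ s ∈ O' := by
    intro s hs
    have h1 := hA' 1 h1A s (hU'sub hs).1
    exact ⟨h1.1, by rw [Set.mem_preimage, h1.2]; exact hs⟩
  refine ⟨{ dom := W, img := U', proj := Q, sec := σ, isOpen_dom := ?_, isOpen_img := hU',
            proj_mem := ?_, sec_mem := fun s hs => ⟨1, hσO s hs⟩, proj_sec := ?_, smul_mem := ?_,
            proj_smul := ?_, exists_smul := ?_, contMDiffAt_proj := ?_,
            contMDiffAt_sec := fun s hs => hσ s (hU'sub hs).1 }, ?_⟩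
  · have : W = ⋃ g : G, (fun y : N => g • y) ⁻¹' O' := by
      ext y; simp [W]
    rw [this]
    exact isOpen_iUnion fun g => hO'.preimage (continuous_const_smul g)
  · rintro y ⟨g, hg⟩
    rw [hQ g y hg]
    exact hg.2
  · intro s hs
    rw [hQ 1 _ (hσO s hs), (hA' 1 h1A s (hU'sub hs).1).2]
  · rintro g y ⟨h, hh⟩
    exact ⟨h * g⁻¹, by rwa [mul_smul, inv_smul_smul]⟩
  · rintro g y ⟨h, hh⟩
    rw [hQ h y hh, hQ (h * g⁻¹) (g • y) (by rwa [mul_smul, inv_smul_smul]), mul_smul,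
      inv_smul_smul]
  · rintro y ⟨g, hg⟩
    refine ⟨g⁻¹ * p (g • y), ?_⟩
    rw [hQ g y hg, mul_smul, hpq _ hg.1, inv_smul_smul]
  · rintro y ⟨g, hg⟩
    have h1 : ContMDiffAt 𝓘(ℝ, E) 𝓘(ℝ, S) ∞ (fun z => q (g • z)) y :=
      ContMDiffAt.comp (g := q) y (hq _ hg.1) (contMDiff_smul_left F g y)
    refine h1.congr_of_eventuallyEq ?_
    filter_upwards [(continuous_const_smul g).continuousAt.eventually (hO'.mem_nhds hg)] with z hz
    exact hQ g z hz
  · exact ⟨1, by simpa [hσ0] using hσO 0 h0U'⟩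

end

variable {S}

namespace SliceChart

variable (c : SliceChart E S N G)

theorem out_mem {y : N} (hy : y ∈ c.dom) : Quotient.out (orbitProj G N y) ∈ c.dom := by
  obtain ⟨g, hg⟩ := exists_smul_out (G := G) y
  have h := c.smul_mem g⁻¹ y hy
  rwa [inv_smul_eq_iff.2 hg.symm] at h

theorem proj_out {y : N} (hy : y ∈ c.dom) :
    c.proj (Quotient.out (orbitProj G N y)) = c.proj y := by
  obtain ⟨g, hg⟩ := exists_smul_out (G := G) y
  conv_rhs => rw [← hg]
  exact (c.proj_smul g _ (c.out_mem hy)).symm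

/-- The chart of the orbit space given by a slice. -/
def chart [ContinuousConstSMul G N] :
    OpenPartialHomeomorph (MulAction.orbitRel.Quotient G N) S where
  toFun p := c.proj (Quotient.out p)
  invFun s := orbitProj G N (c.sec s)
  source := orbitProj G N '' c.dom
  target := c.img
  map_source' := by
    rintro _ ⟨y, hy, rfl⟩
    exact c.proj_mem _ (c.out_mem hy)
  map_target' s hs := ⟨_, c.sec_mem s hs, rfl⟩
  left_inv' := by
    rintro _ ⟨y, hy, rfl⟩
    rw [c.proj_out hy]
    obtain ⟨g, hg⟩ := c.exists_smul y hy
    exact orbitProj_eq_iff.2 ⟨g⁻¹, by rw [inv_smul_eq_iff, hg]⟩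
  right_inv' s hs := by
    rw [c.proj_out (c.sec_mem s hs), c.proj_sec s hs]
  open_source := isOpenQuotientMap_orbitProj.isOpenMap _ c.isOpen_dom
  open_target := c.isOpen_img
  continuousOn_toFun := by
    rintro _ ⟨y, hy, rfl⟩
    refine ContinuousAt.continuousWithinAt ?_
    rw [isOpenQuotientMap_orbitProj.continuousAt_comp_iff.symm]
    refine (c.contMDiffAt_proj y hy).continuousAt.congr ?_
    filter_upwards [c.isOpen_dom.mem_nhds hy] with z hz
    exact (c.proj_out hz).symm
  continuousOn_invFun s hs :=
    (isOpenQuotientMap_orbitProj.continuous.continuousAt.comp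
      (c.contMDiffAt_sec s hs).continuousAt).continuousWithinAt

theorem mem_chart_source [ContinuousConstSMul G N] {y : N} :
    orbitProj G N y ∈ c.chart.source ↔ y ∈ c.dom := by
  refine ⟨?_, fun hy => ⟨y, hy, rfl⟩⟩
  rintro ⟨z, hz, hzy⟩
  obtain ⟨g, hg⟩ := orbitProj_eq_iff.1 hzy
  rw [← hg] at hz
  simpa using c.smul_mem g⁻¹ _ hz

end SliceChart

variable [ContinuousConstSMul G N]

/-- The charted space structure on the orbit space given by slices through all points. -/
abbrev quotientChartedSpace (c : N → SliceChart E S N G) (hc : ∀ x, x ∈ (c x).dom) :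
    ChartedSpace S (MulAction.orbitRel.Quotient G N) where
  atlas := Set.range fun x => (c x).chart
  chartAt p := (c (Quotient.out p)).chart
  mem_chart_source p := by
    have h := (c (Quotient.out p)).mem_chart_source.2 (hc (Quotient.out p))
    rwa [orbitProj_out] at h
  chart_mem_atlas p := ⟨_, rfl⟩

/-- A transition map is the section of one slice followed by the projection onto another, and both
are smooth on `N`. -/
theorem quotient_isManifold (c : N → SliceChart E S N G) (hc : ∀ x, x ∈ (c x).dom) :
    letI := quotientChartedSpace c hc
    IsManifold 𝓘(ℝ, S) ∞ (MulAction.orbitRel.Quotient G N) := by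
  let := quotientChartedSpace c hc
  refine isManifold_of_contDiffOn _ _ _ ?_
  rintro _ _ ⟨x, rfl⟩ ⟨x', rfl⟩
  rintro s ⟨hs, -⟩
  simp only [modelWithCornersSelf_coe_symm, Set.preimage_id] at hs
  rw [OpenPartialHomeomorph.trans_source] at hs
  have hs1 : s ∈ (c x).img := hs.1
  have hs2 : (c x).sec s ∈ (c x').dom := (c x').mem_chart_source.1 hs.2
  refine ContDiffAt.contDiffWithinAt ?_
  have h : ContMDiffAt 𝓘(ℝ, S) 𝓘(ℝ, S) ∞ (fun s => (c x').proj ((c x).sec s)) s :=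
    ContMDiffAt.comp (g := (c x').proj) s ((c x').contMDiffAt_proj _ hs2)
      ((c x).contMDiffAt_sec s hs1)
  refine h.contDiffAt.congr_of_eventuallyEq ?_
  filter_upwards [((c x).contMDiffAt_sec s hs1).continuousAt.eventually
    ((c x').isOpen_dom.mem_nhds hs2)] with t ht
  exact (c x').proj_out ht

variable [TopologicalSpace G]

/-- The quotient manifold theorem. -/
theorem exists_quotientManifold (F : Type*) [NormedAddCommGroup F] [NormedSpace ℝ F]
    (S : Type*) [NormedAddCommGroup S] [NormedSpace ℝ S]
    [FiniteDimensional ℝ E] [FiniteDimensional ℝ F] [FiniteDimensional ℝ S]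
    [IsManifold 𝓘(ℝ, E) ∞ N] [ChartedSpace F G] [LieGroup 𝓘(ℝ, F) ∞ G]
    [ContMDiffSMul 𝓘(ℝ, F) 𝓘(ℝ, E) ∞ G N] [ProperSMul G N]
    (hdim : Module.finrank ℝ F + Module.finrank ℝ S = Module.finrank ℝ E)
    (hfree : ∀ (g : G) (x : N), g • x = x → g = 1) :
    ∃ _ : ChartedSpace S (MulAction.orbitRel.Quotient G N),
    ∃ _ : IsManifold 𝓘(ℝ, S) ∞ (MulAction.orbitRel.Quotient G N),
      ContMDiff 𝓘(ℝ, E) 𝓘(ℝ, S) ∞ (orbitProj G N) ∧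
      ∀ y : N, ∃ τ : MulAction.orbitRel.Quotient G N → N, τ (orbitProj G N y) = y ∧
        ContMDiffAt 𝓘(ℝ, S) 𝓘(ℝ, E) ∞ τ (orbitProj G N y) ∧
        ∀ᶠ p in 𝓝 (orbitProj G N y), orbitProj G N (τ p) = p := by
  choose c hc using exists_sliceChart F S (N := N) (G := G) hdim hfree
  let cs := quotientChartedSpace c hc
  have im := quotient_isManifold c hc
  have hmem : ∀ y : N, y ∈ (c (Quotient.out (orbitProj G N y))).dom := fun y =>
    (c _).mem_chart_source.1 (mem_chart_source S (orbitProj G N y))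
  refine ⟨cs, im, ?_, ?_⟩
  · intro y
    rw [contMDiffAt_iff_target]
    refine ⟨isOpenQuotientMap_orbitProj.continuous.continuousAt, ?_⟩
    refine ((c (Quotient.out (orbitProj G N y))).contMDiffAt_proj y
      (hmem y)).congr_of_eventuallyEq ?_
    filter_upwards [(c (Quotient.out (orbitProj G N y))).isOpen_dom.mem_nhds (hmem y)] with z hz
    exact (c _).proj_out hz
  · intro y
    let d := c (Quotient.out (orbitProj G N y))
    have hd : y ∈ d.dom := hmem y
    obtain ⟨g, hg⟩ := d.exists_smul y hd
    have hy : d.chart (orbitProj G N y) = d.proj y := d.proj_out hd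
    have hsec : ContMDiffAt 𝓘(ℝ, S) 𝓘(ℝ, E) ∞ d.sec (d.chart (orbitProj G N y)) := by
      rw [hy]
      exact d.contMDiffAt_sec _ (d.proj_mem y hd)
    have hchart : ContMDiffAt 𝓘(ℝ, S) 𝓘(ℝ, S) ∞ d.chart (orbitProj G N y) :=
      contMDiffAt_extChartAt (I := 𝓘(ℝ, S)) (x := orbitProj G N y)
    -- The slice section meets the orbit of `y` in a point that need not be `y`; translating by `g`
    -- makes it pass through `y` without changing orbits.
    refine ⟨fun p => g • d.sec (d.chart p), ?_, ?_, ?_⟩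
    · simp only [hy, hg]
    · exact ContMDiffAt.comp (g := fun z : N => g • z) _ (contMDiff_smul_left F g _)
        (ContMDiffAt.comp (g := d.sec) _ hsec hchart)
    · filter_upwards [d.chart.open_source.mem_nhds (d.mem_chart_source.2 hd)] with p hp
      rw [orbitProj_smul]
      exact d.chart.left_inv hp

end QuotientManifold

/-! ### Multivectors -/

section Multivectors

/-- The wedges of an independent family indexed by `k`-element subsets are independent. Here the
only such subset is all of `Fin k`, and its wedge is that of `u` up to a permutation. -/
theorem ιMulti_ne_zero_of_linearIndependent {V : Type*} [AddCommGroup V] [Module ℝ V] {k : ℕ}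
    {u : Fin k → V} (hu : LinearIndependent ℝ u) : exteriorPower.ιMulti ℝ k u ≠ 0 := by
  intro h
  let s : Set.powersetCard (Fin k) k := ⟨Finset.univ, by simp [Set.powersetCard]⟩
  refine (exteriorPower.ιMulti_family_linearIndependent_field (n := k) hu).ne_zero s ?_
  let e := Equiv.ofBijective (Set.powersetCard.ofFinEmbEquiv.symm s)
    (Finite.injective_iff_bijective.1 (Set.powersetCard.ofFinEmbEquiv.symm s).injective)
  have h1 : exteriorPower.ιMulti_family ℝ k u s = exteriorPower.ιMulti ℝ k (u ∘ e) := rfl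
  rw [h1, AlternatingMap.map_perm, h, smul_zero]

/-- A top degree multivector is a multiple of the wedge product of the vectors of a basis. -/
theorem exists_eq_smul_ιMulti {V : Type*} [AddCommGroup V] [Module ℝ V] {k : ℕ}
    (b : Module.Basis (Fin k) ℝ V) {w : ⋀[ℝ]^k V} (hw : w ≠ 0) :
    ∃ c : ℝ, c ≠ 0 ∧ w = c • exteriorPower.ιMulti ℝ k b := by
  have : FiniteDimensional ℝ V := b.finiteDimensional_of_finite
  have h1 : Module.finrank ℝ (⋀[ℝ]^k V) = 1 := by
    rw [exteriorPower.finrank_eq, Module.finrank_eq_card_basis b]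
    simp
  obtain ⟨c, hc⟩ := exists_smul_eq_of_finrank_eq_one h1
    (ιMulti_ne_zero_of_linearIndependent b.linearIndependent) w
  refine ⟨c, ?_, hc.symm⟩
  rintro rfl
  exact hw (by rw [← hc, zero_smul])

theorem ιMulti_mul_ιMulti {V : Type*} [AddCommGroup V] [Module ℝ V] {l m : ℕ} (u : Fin l → V)
    (v : Fin m → V) :
    ExteriorAlgebra.ιMulti ℝ l u * ExteriorAlgebra.ιMulti ℝ m v =
      ExteriorAlgebra.ιMulti ℝ (l + m) (Fin.append u v) := by
  simp only [ExteriorAlgebra.ιMulti_apply]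
  rw [← List.prod_append, ← List.ofFn_fin_append]
  congr 2
  funext i
  refine Fin.addCases (fun i => ?_) (fun i => ?_) i <;> simp

variable {T : Type*} [AddCommGroup T] [Module ℝ T] [TopologicalSpace T]

theorem pairing_ιMulti_of_ne {k l : ℕ} (α : T [⋀^Fin k]→L[ℝ] ℝ) (hl : l ≠ k) (v : Fin l → T) :
    pairing α (ExteriorAlgebra.ιMulti ℝ l v) = 0 := by
  simp [pairing, ExteriorAlgebra.liftAlternating_apply_ιMulti, Pi.single_eq_of_ne hl]

/-- If the contraction of an `(r + 1)`-nondegenerate form with the independent vectors `u` and with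
`v` vanishes, then `v` is in the span of `u`. -/
theorem mem_span_of_isNondegenerate {r m : ℕ} {α : T [⋀^Fin (r + (m + 1))]→L[ℝ] ℝ}
    (hα : IsNondegenerate (r + 1) α) {u : Fin r → T} (hu : LinearIndependent ℝ u) {v : T}
    (h : ∀ z : Fin m → T, α (Fin.append u (Matrix.vecCons v z)) = 0) :
    v ∈ Submodule.span ℝ (Set.range u) := by
  by_contra hv
  -- If `v` were outside the span, `u ∧ v` would be non-zero. Nondegeneracy tests it against the
  -- whole exterior algebra, which is spanned by wedges: those of degree `m` are covered by `h`, all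
  -- others pair to zero for degree reasons.
  refine ιMulti_ne_zero_of_linearIndependent (linearIndependent_finSnoc.2 ⟨hu, hv⟩)
    (Subtype.ext (hα _ (exteriorPower.ιMulti ℝ (r + 1) _).2 fun z => ?_))
  have hz : z ∈ Submodule.span ℝ (Set.range fun x : Σ n, (Fin n → T) =>
    ExteriorAlgebra.ιMulti ℝ x.1 x.2) := by
    rw [ExteriorAlgebra.ιMulti_span]
    trivial
  induction hz using Submodule.span_induction with
  | mem x hx =>
    obtain ⟨⟨j, z⟩, rfl⟩ := hx
    have e1 : ExteriorAlgebra.ιMulti ℝ (r + 1) (Fin.snoc u v : Fin (r + 1) → T) =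
        ExteriorAlgebra.ιMulti ℝ r u * ExteriorAlgebra.ι ℝ v := by
      rw [Fin.snoc_eq_append]
      rw [← ιMulti_mul_ιMulti]
      simp [ExteriorAlgebra.ιMulti_succ_apply]
    have e2 : ExteriorAlgebra.ι ℝ v * ExteriorAlgebra.ιMulti ℝ j z =
        ExteriorAlgebra.ιMulti ℝ (j + 1) (Matrix.vecCons v z) := by
      rw [ExteriorAlgebra.ιMulti_succ_apply]
      simp
    simp only [exteriorPower.ιMulti_apply_coe]
    rw [e1, mul_assoc, e2]
    by_cases hj : j = m
    · subst hj
      rw [pairing_ιMulti_mul_ιMulti]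
      exact h z
    · rw [ιMulti_mul_ιMulti]
      exact pairing_ιMulti_of_ne _ (by omega) _
  | zero => simp
  | add x y _ _ hx hy => rw [mul_add, map_add, hx, hy, add_zero]
  | smul a x _ hx => rw [mul_smul_comm, map_smul, hx, smul_zero]

end Multivectors

/-! ### Contraction with a multivector field of fundamental fields -/

section FundamentalFields

variable {E : Type*} [NormedAddCommGroup E] [NormedSpace ℝ E]
  {N : Type*} [TopologicalSpace N] [ChartedSpace E N]
  {r : ℕ} {F : Type*} [NormedAddCommGroup F] [NormedSpace ℝ F]
  {G : Type*} [TopologicalSpace G] [ChartedSpace F G] [Group G]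
  [MulAction G N]

/-- The contraction with `0 ≠ w ∈ Λ^r V_Φ` for a locally free action of an `r`-dimensional group is
a multiple of the contraction with the fundamental fields of a basis of the Lie algebra. -/
theorem DForm.exists_val_contractMulti [Nonempty N] (b : Module.Basis (Fin r) ℝ F)
    (hinj : ∀ x : N, Function.Injective (mderiv F E (fun g : G => g • x) 1))
    {w : ⋀[ℝ]^r (fundamentalFields E N F G)} (hw : w ≠ 0) :
    ∃ c : ℝ, c ≠ 0 ∧ ∀ {k : ℕ} (Θ : DForm E N (r + k)) (x : N) (v : Fin k → E),
      (Θ.contractMulti w).val x v =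
        c * Θ.val x (Fin.append (fun i => mderiv F E (fun g : G => g • x) 1 (b i)) v) := by
  -- A fundamental field is determined by its value at a single point, so `V_Φ` has dimension
  -- exactly `r` and its top exterior power is a line.
  have hf : Function.Injective (fundamentalField E N F G) := by
    intro ζ ζ' h
    obtain ⟨x⟩ := ‹Nonempty N›
    exact hinj x (congrFun h x)
  let b' : Module.Basis (Fin r) ℝ (TangentSpace 𝓘(ℝ, F) (1 : G)) := b
  let e : TangentSpace 𝓘(ℝ, F) (1 : G) ≃ₗ[ℝ] fundamentalFields E N F G :=
    LinearEquiv.ofInjective (fundamentalField E N F G) hf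
  obtain ⟨c, hc, hwc⟩ := exists_eq_smul_ιMulti
    (b'.map e) hw
  refine ⟨c, hc, fun {k} Θ x v => ?_⟩
  have h1 : multivectorAt w x = c • exteriorPower.ιMulti ℝ r
      (fun i => fundamentalField E N F G (b' i) x) := by
    rw [multivectorAt, hwc, map_smul, exteriorPower.map_apply_ιMulti]
    rfl
  let v' : Fin k → TangentSpace 𝓘(ℝ, E) x := v
  change pairing (Θ x) ((multivectorAt w x : ExteriorAlgebra ℝ (TangentSpace 𝓘(ℝ, E) x)) *
    ExteriorAlgebra.ιMulti ℝ k v') = _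
  rw [h1]
  simp only [SetLike.val_smul, exteriorPower.ιMulti_apply_coe, smul_mul_assoc, map_smul,
    smul_eq_mul]
  congr 1
  exact pairing_ιMulti_mul_ιMulti (T := TangentSpace 𝓘(ℝ, E) x) (Θ x)
    (fun i => fundamentalField E N F G (b' i) x) v'

end FundamentalFields

/-! ### Descent of forms along a submersion -/

section Descent

/-- The arguments are exchanged one at a time; each exchange changes the value by a term having an
entry in `K`. -/
theorem alternating_apply_eq_of_sub_mem {V : Type*} [AddCommGroup V] [Module ℝ V]
    [TopologicalSpace V] {k : ℕ} {α : V [⋀^Fin k]→L[ℝ] ℝ} {K : Set V}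
    (hα : ∀ v : Fin k → V, (∃ i, v i ∈ K) → α v = 0) {u v : Fin k → V}
    (huv : ∀ i, u i - v i ∈ K) : α u = α v := by
  classical
  have h : ∀ s : Finset (Fin k), α (s.piecewise u v) = α v := by
    intro s
    induction s using Finset.induction_on with
    | empty => simp
    | insert j s hj ih =>
      have h1 : α (Function.update (s.piecewise u v) j (u j - v j)) = 0 :=
        hα _ ⟨j, by simpa using huv j⟩
      have h2 : Function.update (s.piecewise u v) j (v j) = s.piecewise u v := by
        rw [Function.update_eq_self_iff, Finset.piecewise_eq_of_notMem _ _ _ hj]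
      rw [α.map_update_sub, h2, ih, sub_eq_zero] at h1
      rw [Finset.piecewise_insert, h1]
  simpa using h Finset.univ

variable {E : Type*} [NormedAddCommGroup E] [NormedSpace ℝ E]
  {S : Type*} [NormedAddCommGroup S] [NormedSpace ℝ S]
  {N : Type*} [TopologicalSpace N] [ChartedSpace E N]
  {Q : Type*} [TopologicalSpace Q] [ChartedSpace S Q]

/-- Through every point of `N` there is a smooth local section of `p`. -/
def HasLocalSections (E S : Type*) [NormedAddCommGroup E] [NormedSpace ℝ E]
    [NormedAddCommGroup S] [NormedSpace ℝ S] {N : Type*} [TopologicalSpace N] [ChartedSpace E N]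
    {Q : Type*} [TopologicalSpace Q] [ChartedSpace S Q] (p : N → Q) : Prop :=
  ∀ y : N, ∃ τ : Q → N, τ (p y) = y ∧ ContMDiffAt 𝓘(ℝ, S) 𝓘(ℝ, E) ∞ τ (p y) ∧
    ∀ᶠ q in 𝓝 (p y), p (τ q) = q

variable {p : N → Q}

theorem HasLocalSections.exists_right_inverse (hsec : HasLocalSections E S p)
    (hp : ContMDiff 𝓘(ℝ, E) 𝓘(ℝ, S) ∞ p) (y : N) :
    ∃ R : S →L[ℝ] E, (mderiv E S p y).comp R = ContinuousLinearMap.id ℝ S := by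
  obtain ⟨τ, h1, h2, h3⟩ := hsec y
  refine ⟨mderiv S E τ (p y), ?_⟩
  have := mderiv_left_inverse (E := S) (E' := E) (g := p) (f := τ) (x := p y)
    (hp.mdifferentiable (by simp) _) (h2.mdifferentiableAt (by simp)) h3
  rwa [h1] at this

theorem HasLocalSections.surjective_mderiv (hsec : HasLocalSections E S p)
    (hp : ContMDiff 𝓘(ℝ, E) 𝓘(ℝ, S) ∞ p) (y : N) :
    Function.Surjective (mderiv E S p y) := by
  obtain ⟨R, hR⟩ := hsec.exists_right_inverse hp y
  exact fun v => ⟨R v, congrArg (fun L : S →L[ℝ] S => L v) hR⟩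

/-- A form is basic if its value on vectors depends only on their projections to `Q`. -/
def DForm.IsBasic {k : ℕ} (S : Type*) [NormedAddCommGroup S] [NormedSpace ℝ S]
    {Q : Type*} [TopologicalSpace Q] [ChartedSpace S Q] (p : N → Q) (β : DForm E N k) : Prop :=
  ∀ (x y : N) (u v : Fin k → E), p x = p y →
    (∀ i, mderiv E S p x (u i) = mderiv E S p y (v i)) → β.val x u = β.val y v

/-- Choose a point over each `q` and a linear lift of tangent vectors there; basicness says that
these choices do not matter. The choice is not smooth in `q`, so regularity is recovered separately
from local sections. -/
theorem DForm.IsBasic.exists_pullback_eq {k : ℕ} {β : DForm E N k} (hβ : β.IsBasic S p)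
    (hsec : HasLocalSections E S p) (hp : ContMDiff 𝓘(ℝ, E) 𝓘(ℝ, S) ∞ p)
    (hsurj : Function.Surjective p) : ∃ β' : DForm S Q k, DForm.pullback p β' = β := by
  obtain ⟨s, hs⟩ := hsurj.hasRightInverse
  choose R hR using fun q => hsec.exists_right_inverse hp (s q)
  refine ⟨fun q => (β.val (s q)).compContinuousLinearMap (R q), DForm.ext_val fun x => ?_⟩
  ext v
  refine hβ (s (p x)) x (fun i => R (p x) (mderiv E S p x (v i))) v (hs _) fun i => ?_
  exact congrArg (fun L : S →L[ℝ] S => L (mderiv E S p x (v i))) (hR (p x))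

theorem DForm.pullback_injective {k : ℕ}
    (hsec : HasLocalSections E S p) (hp : ContMDiff 𝓘(ℝ, E) 𝓘(ℝ, S) ∞ p)
    (hsurj : Function.Surjective p) :
    Function.Injective (DForm.pullback (E := E) (E' := S) (k := k) p) := by
  intro α β h
  refine DForm.ext_val fun q => ?_
  obtain ⟨x, rfl⟩ := hsurj q
  obtain ⟨R, hR⟩ := hsec.exists_right_inverse hp x
  have h1 : ∀ v, mderiv E S p x (R v) = v := fun v =>
    congrArg (fun L : S →L[ℝ] S => L v) hR
  ext v
  have h2 : α.val (p x) (fun i => mderiv E S p x (R (v i))) =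
      β.val (p x) (fun i => mderiv E S p x (R (v i))) :=
    congrArg (fun γ : DForm E N k => γ.val x fun i => R (v i)) h
  simpa only [h1] using h2

variable [IsManifold 𝓘(ℝ, E) ∞ N] [IsManifold 𝓘(ℝ, S) ∞ Q]

/-- A form on `Q` is locally the pullback along a section of its pullback to `N`. -/
theorem HasLocalSections.exists_eventually_val_eq {k : ℕ} (β : DForm S Q k)
    (hsec : HasLocalSections E S p) (hp : ContMDiff 𝓘(ℝ, E) 𝓘(ℝ, S) ∞ p)
    (hsurj : Function.Surjective p) (q : Q) :
    ∃ τ : Q → N, ContMDiffAt 𝓘(ℝ, S) 𝓘(ℝ, E) ∞ τ q ∧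
      ∀ᶠ z in 𝓝 q, β.val z =
        (DForm.pullback (E := S) τ (DForm.pullback (E := E) p β)).val z := by
  obtain ⟨y, rfl⟩ := hsurj q
  obtain ⟨τ, h1, h2, h3⟩ := hsec y
  refine ⟨τ, h2, ?_⟩
  filter_upwards [h3.eventually_nhds, eventually_mdifferentiableAt h2] with z hz hd
  rw [← DForm.val_pullback_comp β (hp.mdifferentiable (by simp) _) hd,
    DForm.val_pullback_congr β (f' := fun z => z) hz, DForm.val_pullback, mderiv_id]
  rfl

theorem HasLocalSections.isSmooth_of_pullback [FiniteDimensional ℝ S] {k : ℕ} {β : DForm S Q k}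
    (hsec : HasLocalSections E S p) (hp : ContMDiff 𝓘(ℝ, E) 𝓘(ℝ, S) ∞ p)
    (hsurj : Function.Surjective p) (hβ : (DForm.pullback (E := E) p β).IsSmooth) : β.IsSmooth :=
  DForm.isSmooth_of_local hβ (hsec.exists_eventually_val_eq β hp hsurj)

theorem HasLocalSections.isClosed_of_pullback {k : ℕ} {β : DForm S Q k}
    (hsec : HasLocalSections E S p) (hp : ContMDiff 𝓘(ℝ, E) 𝓘(ℝ, S) ∞ p)
    (hsurj : Function.Surjective p) (hβ : (DForm.pullback (E := E) p β).IsSmooth)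
    (hd : (DForm.pullback (E := E) p β).IsClosed) : β.IsClosed :=
  DForm.isClosed_of_local hβ hd (hsec.exists_eventually_val_eq β hp hsurj)

end Descent

/-! ### Basic forms for a group action -/

section OrbitForms

variable {E : Type*} [NormedAddCommGroup E] [NormedSpace ℝ E]
  {S : Type*} [NormedAddCommGroup S] [NormedSpace ℝ S]
  {N : Type*} [TopologicalSpace N] [ChartedSpace E N]
  {Q : Type*} [TopologicalSpace Q] [ChartedSpace S Q] {p : N → Q}
  {F : Type*} [NormedAddCommGroup F] [NormedSpace ℝ F]
  {G : Type*} [TopologicalSpace G] [ChartedSpace F G] [Group G] [MulAction G N]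
  [ContMDiffSMul 𝓘(ℝ, F) 𝓘(ℝ, E) ∞ G N]

/-- Vectors tangent to the orbits are projected to zero. -/
theorem mderiv_smul_point_mem_ker (hp : ContMDiff 𝓘(ℝ, E) 𝓘(ℝ, S) ∞ p)
    (hinv : ∀ (g : G) (x : N), p (g • x) = p x) (g : G) (x : N) (ζ : F) :
    mderiv E S p (g • x) (mderiv F E (fun h : G => h • x) g ζ) = 0 := by
  have e1 := mderiv_comp (E := F) (E' := E) (E'' := S) (g := p) (f := fun h : G => h • x) (x := g)
    (hp.mdifferentiable (by simp) _) ((contMDiff_smul_point F x).mdifferentiable (by simp) _)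
  have e2 : (fun h : G => p (h • x)) = fun _ => p x := funext fun h => hinv h x
  rw [e2, mderiv_const] at e1
  exact (congrArg (fun L : F →L[ℝ] S => L ζ) e1).symm

/-- The kernel of the derivative of the orbit projection consists of the vectors tangent to the
orbits. -/
theorem exists_eq_mderiv_smul_point [FiniteDimensional ℝ E] [FiniteDimensional ℝ F]
    [FiniteDimensional ℝ S]
    (hp : ContMDiff 𝓘(ℝ, E) 𝓘(ℝ, S) ∞ p) (hsec : HasLocalSections E S p)
    (hinv : ∀ (g : G) (x : N), p (g • x) = p x)
    (hdim : Module.finrank ℝ F + Module.finrank ℝ S = Module.finrank ℝ E) {x : N}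
    (hinj : Function.Injective (mderiv F E (fun g : G => g • x) 1)) {v : E}
    (hv : mderiv E S p x v = 0) : ∃ ζ, mderiv F E (fun g : G => g • x) 1 ζ = v := by
  have h1 : (mderiv F E (fun g : G => g • x) 1).toLinearMap.range ≤
      (mderiv E S p x).toLinearMap.ker := by
    rintro _ ⟨ζ, rfl⟩
    have := mderiv_smul_point_mem_ker hp hinv (1 : G) x ζ
    rwa [one_smul] at this
  have h2 := LinearMap.finrank_range_of_inj
    (f := (mderiv F E (fun g : G => g • x) 1).toLinearMap) hinj
  have h3 := (mderiv E S p x).toLinearMap.finrank_range_add_finrank_ker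
  rw [LinearMap.range_eq_top.2 (hsec.surjective_mderiv hp x), finrank_top] at h3
  have h4 : v ∈ (mderiv F E (fun g : G => g • x) 1).toLinearMap.range := by
    -- The orbit directions lie in the kernel, and by `hdim` and surjectivity both spaces have the
    -- dimension of `F`.
    rw [Submodule.eq_of_le_of_finrank_eq h1 (by omega)]
    exact hv
  exact h4

variable (F)

/-- The action in charts at `g` and `x`. -/
def chartAction (E : Type*) [NormedAddCommGroup E] [NormedSpace ℝ E]
    {N : Type*} [TopologicalSpace N] [ChartedSpace E N]
    (F : Type*) [NormedAddCommGroup F] [NormedSpace ℝ F]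
    {G : Type*} [TopologicalSpace G] [ChartedSpace F G] [Group G] [MulAction G N]
    (g : G) (x : N) (a : F × E) : N :=
  (extChartAt 𝓘(ℝ, F) g).symm a.1 • (extChartAt 𝓘(ℝ, E) x).symm a.2

variable [IsManifold 𝓘(ℝ, E) ∞ N]

theorem contMDiffAt_chartAction [IsManifold 𝓘(ℝ, F) ∞ G] {g : G} {x : N} {a : F × E}
    (h1 : a.1 ∈ (extChartAt 𝓘(ℝ, F) g).target) (h2 : a.2 ∈ (extChartAt 𝓘(ℝ, E) x).target) :
    ContMDiffAt 𝓘(ℝ, F × E) 𝓘(ℝ, E) ∞ (chartAction E F g x) a := by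
  have e1 : ContMDiffAt 𝓘(ℝ, F × E) 𝓘(ℝ, F) ∞ (fun a : F × E => (extChartAt 𝓘(ℝ, F) g).symm a.1) a
      :=
    ContMDiffAt.comp (g := (extChartAt 𝓘(ℝ, F) g).symm) a (contMDiffAt_extChartAt_symm h1)
      contDiff_fst.contMDiff.contMDiffAt
  have e2 : ContMDiffAt 𝓘(ℝ, F × E) 𝓘(ℝ, E) ∞ (fun a : F × E => (extChartAt 𝓘(ℝ, E) x).symm a.2) a
      :=
    ContMDiffAt.comp (g := (extChartAt 𝓘(ℝ, E) x).symm) a (contMDiffAt_extChartAt_symm h2)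
      contDiff_snd.contMDiff.contMDiffAt
  exact ContMDiffAt.comp (g := fun p : G × N => p.1 • p.2) a (contMDiff_action E F N G _)
    (e1.prodMk e2)

theorem mderiv_chartAction_inr [IsManifold 𝓘(ℝ, F) ∞ G] {g : G} {x : N} {a : F}
    (h1 : a ∈ (extChartAt 𝓘(ℝ, F) g).target) {y : E} (h2 : y ∈ (extChartAt 𝓘(ℝ, E) x).target)
    (v : E) :
    mderiv (F × E) E (chartAction E F g x) (a, y) (0, v) =
      mderiv E E (fun z : N => (extChartAt 𝓘(ℝ, F) g).symm a • z) ((extChartAt 𝓘(ℝ, E) x).symm y)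
        (mderiv E E (extChartAt 𝓘(ℝ, E) x).symm y v) := by
  have e0 : mderiv E (F × E) (fun y : E => (a, y)) y = ContinuousLinearMap.inr ℝ F E :=
    (mderiv_eq_fderiv _ _).trans (hasFDerivAt_prodMk_right a y).fderiv
  have e1 := mderiv_comp (E := E) (E' := F × E) (E'' := E) (g := chartAction E F g x)
    (f := fun y : E => (a, y)) (x := y)
    ((contMDiffAt_chartAction F (a := (a, y)) h1 h2).mdifferentiableAt (by simp))
    (hasFDerivAt_prodMk_right a y).differentiableAt.mdifferentiableAt
  have e2 := mderiv_comp (E := E) (E' := E) (E'' := E)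
    (g := fun z : N => (extChartAt 𝓘(ℝ, F) g).symm a • z) (f := (extChartAt 𝓘(ℝ, E) x).symm)
    (x := y) ((contMDiff_smul_left F _).mdifferentiable (by simp) _)
    ((contMDiffAt_extChartAt_symm h2).mdifferentiableAt (by simp))
  rw [e0] at e1
  exact congrArg (fun L : E →L[ℝ] E => L v) (e1.symm.trans e2)

theorem mderiv_chartAction_inl [IsManifold 𝓘(ℝ, F) ∞ G] {g : G} {x : N} {a : F}
    (h1 : a ∈ (extChartAt 𝓘(ℝ, F) g).target) {y : E} (h2 : y ∈ (extChartAt 𝓘(ℝ, E) x).target)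
    (ζ : F) :
    mderiv (F × E) E (chartAction E F g x) (a, y) (ζ, 0) =
      mderiv F E (fun h : G => h • (extChartAt 𝓘(ℝ, E) x).symm y) ((extChartAt 𝓘(ℝ, F) g).symm a)
        (mderiv F F (extChartAt 𝓘(ℝ, F) g).symm a ζ) := by
  have e0 : mderiv F (F × E) (fun a : F => (a, y)) a = ContinuousLinearMap.inl ℝ F E :=
    (mderiv_eq_fderiv _ _).trans (hasFDerivAt_prodMk_left a y).fderiv
  have e1 := mderiv_comp (E := F) (E' := F × E) (E'' := E) (g := chartAction E F g x)
    (f := fun a : F => (a, y)) (x := a)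
    ((contMDiffAt_chartAction F (a := (a, y)) h1 h2).mdifferentiableAt (by simp))
    (hasFDerivAt_prodMk_left a y).differentiableAt.mdifferentiableAt
  have e2 := mderiv_comp (E := F) (E' := F) (E'' := E)
    (g := fun h : G => h • (extChartAt 𝓘(ℝ, E) x).symm y) (f := (extChartAt 𝓘(ℝ, F) g).symm)
    (x := a) ((contMDiff_smul_point F _).mdifferentiable (by simp) _)
    ((contMDiffAt_extChartAt_symm h1).mdifferentiableAt (by simp))
  rw [e0] at e1
  exact congrArg (fun L : F →L[ℝ] E => L ζ) (e1.symm.trans e2)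

variable {F}

/-- A closed form which is annihilated by the vectors tangent to the orbits of a connected group is
invariant. -/
theorem DForm.IsClosed.val_pullback_smul [FiniteDimensional ℝ E] [FiniteDimensional ℝ F]
    [IsManifold 𝓘(ℝ, F) ∞ G] [PreconnectedSpace G]
    {k : ℕ} {β : DForm E N k} (hd : β.IsClosed) (hβ : β.IsSmooth)
    (hp : ContMDiff 𝓘(ℝ, E) 𝓘(ℝ, S) ∞ p) (hinv : ∀ (g : G) (x : N), p (g • x) = p x)
    (hker : ∀ (x : N) (v : Fin k → E), (∃ i, mderiv E S p x (v i) = 0) → β.val x v = 0)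
    (g : G) (x : N) :
    (DForm.pullback (E := E) (fun y : N => g • y) β).val x = β.val x := by
  have hy := mem_extChartAt_target (I := 𝓘(ℝ, E)) x
  have hconst : IsLocallyConstant
      fun g : G => (DForm.pullback (E := E) (fun y : N => g • y) β).val x := by
    rw [IsLocallyConstant.iff_eventually_eq]
    intro g
    -- The pullback of `β` along the action is closed. The vectors `(ζ, 0)` go to vectors tangent to
    -- orbits and annihilate it, so its coefficients do not vary in the group direction.
    let α : F × E → (F × E) [⋀^Fin k]→L[ℝ] ℝ :=
      (DForm.pullback (E := F × E) (chartAction E F g x) β).val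
    have hα : ∀ a ∈ (extChartAt 𝓘(ℝ, F) g).target,
        DifferentiableAt ℝ α (a, extChartAt 𝓘(ℝ, E) x x) := fun a ha =>
      (hβ.contDiffAt_pullback (contMDiffAt_chartAction F ha hy)).differentiableAt (by simp)
    have hα0 : ∀ a ∈ (extChartAt 𝓘(ℝ, F) g).target, ∀ ζ : F,
        fderiv ℝ α (a, extChartAt 𝓘(ℝ, E) x x) (ζ, 0) = 0 := by
      intro a ha ζ
      refine fderiv_apply_eq_zero_of_extDeriv (hα a ha)
        (hβ.extDeriv_pullback hd (contMDiffAt_chartAction F ha hy)) ?_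
      filter_upwards [((isOpen_extChartAt_target (I := 𝓘(ℝ, F)) g).prod
        (isOpen_extChartAt_target (I := 𝓘(ℝ, E)) x)).mem_nhds ⟨ha, hy⟩] with b hb v ⟨i, hi⟩
      refine hker _ _ ⟨i, ?_⟩
      rw [hi]
      erw [mderiv_chartAction_inl F hb.1 hb.2]
      exact mderiv_smul_point_mem_ker hp hinv _ _ _
    have h1 : ∀ᶠ a in 𝓝 (extChartAt 𝓘(ℝ, F) g g), α (a, extChartAt 𝓘(ℝ, E) x x) =
        α (extChartAt 𝓘(ℝ, F) g g, extChartAt 𝓘(ℝ, E) x x) := by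
      refine eventually_eq_of_mderiv_eq_zero (E := (F × E) [⋀^Fin k]→L[ℝ] ℝ)
        (f := fun a => α (a, extChartAt 𝓘(ℝ, E) x x)) ?_
      filter_upwards [extChartAt_target_mem_nhds (I := 𝓘(ℝ, F)) g] with a ha
      have h2 := HasFDerivAt.comp (g := α) (f := fun a : F => (a, extChartAt 𝓘(ℝ, E) x x)) a
        (hα a ha).hasFDerivAt (hasFDerivAt_prodMk_left a (extChartAt 𝓘(ℝ, E) x x))
      refine ⟨h2.differentiableAt.mdifferentiableAt, ?_⟩
      refine (mderiv_eq_fderiv _ _).trans (h2.fderiv.trans ?_)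
      ext1 ζ
      exact hα0 a ha ζ
    have h3 := (contMDiffAt_extChartAt (I := 𝓘(ℝ, F)) (n := ∞) (x := g)).continuousAt.eventually h1
    filter_upwards [h3, extChartAt_source_mem_nhds (I := 𝓘(ℝ, F)) g] with h hh hs
    -- On vectors `(0, ·)` the form `α` is the pullback of `β` by the translation `h`, so constancy
    -- of `α` gives local constancy of these pullbacks in `h`.
    have h4 : ∀ h ∈ (extChartAt 𝓘(ℝ, F) g).source, ∀ v : Fin k → E,
        α (extChartAt 𝓘(ℝ, F) g h, extChartAt 𝓘(ℝ, E) x x)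
          (fun i => (0, mderiv E E (extChartAt 𝓘(ℝ, E) x) x (v i))) =
        (DForm.pullback (E := E) (fun y : N => h • y) β).val x v := by
      intro h hs v
      change β.val _ (fun i => mderiv (F × E) E _ _ _) = β.val _ (fun i => mderiv E E _ _ _)
      have h5 : ∀ v, mderiv E E (extChartAt 𝓘(ℝ, E) x).symm (extChartAt 𝓘(ℝ, E) x x)
          (mderiv E E (extChartAt 𝓘(ℝ, E) x) x v) = v := fun v =>
        congrArg (fun L : E →L[ℝ] E => L v)
          (mderiv_extChartAt_symm_comp (mem_extChartAt_source (I := 𝓘(ℝ, E)) x))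
      simp only [mderiv_chartAction_inr F ((extChartAt 𝓘(ℝ, F) g).map_source hs) hy, h5,
        chartAction, (extChartAt 𝓘(ℝ, F) g).left_inv hs, extChartAt_to_inv]
    ext v
    rw [← h4 h hs, ← h4 g (mem_extChartAt_source (I := 𝓘(ℝ, F)) g), hh]
  have := hconst.apply_eq_of_preconnectedSpace g 1
  simp only [one_smul] at this
  rw [this, DForm.val_pullback, mderiv_id]
  rfl

/-- Invariance moves both base points to the same one. There the two tuples of vectors differ by
vectors in the kernel of the derivative of `p`, which do not contribute. -/
theorem DForm.IsClosed.isBasic [FiniteDimensional ℝ E] [FiniteDimensional ℝ F]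
    [IsManifold 𝓘(ℝ, F) ∞ G] [PreconnectedSpace G]
    {k : ℕ} {β : DForm E N k} (hd : β.IsClosed) (hβ : β.IsSmooth)
    (hp : ContMDiff 𝓘(ℝ, E) 𝓘(ℝ, S) ∞ p)
    (hpG : ∀ x y : N, p x = p y ↔ ∃ g : G, g • y = x)
    (hker : ∀ (x : N) (v : Fin k → E), (∃ i, mderiv E S p x (v i) = 0) → β.val x v = 0) :
    β.IsBasic S p := by
  intro x y u v hxy huv
  obtain ⟨g, rfl⟩ := (hpG x y).1 hxy
  have hinv : ∀ (g : G) (x : N), p (g • x) = p x := fun g x => (hpG _ _).2 ⟨g, rfl⟩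
  rw [← hd.val_pullback_smul (F := F) hβ hp hinv hker g y]
  refine alternating_apply_eq_of_sub_mem (K := {v : E | mderiv E S p (g • y) v = 0})
    (hker (g • y)) fun i => ?_
  have e1 := mderiv_comp (E := E) (E' := E) (E'' := S) (g := p) (f := fun z : N => g • z) (x := y)
    (hp.mdifferentiable (by simp) _) ((contMDiff_smul_left F g).mdifferentiable (by simp) _)
  have e2 : (fun z : N => p (g • z)) = p := funext fun z => hinv g z
  rw [e2] at e1
  change mderiv E S p (g • y) (u i - mderiv E E (fun z : N => g • z) y (v i)) = 0
  rw [map_sub, huv i, e1, ContinuousLinearMap.comp_apply, sub_self]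

end OrbitForms

/-! ### Vector fields in charts -/

section LocalField

variable {E : Type*} [NormedAddCommGroup E] [NormedSpace ℝ E]
  {M : Type*} [TopologicalSpace M] [ChartedSpace E M]

/-- The expression of a vector field in the preferred chart at `x₀`. -/
def VField.inChart (Y : VField E M) (x₀ : M) (y : E) : E :=
  mderiv E E (extChartAt 𝓘(ℝ, E) x₀) ((extChartAt 𝓘(ℝ, E) x₀).symm y)
    (Y ((extChartAt 𝓘(ℝ, E) x₀).symm y))

variable [IsManifold 𝓘(ℝ, E) ∞ M]

theorem VField.mderiv_inChart (Y : VField E M) {x₀ : M} {y : E}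
    (hy : y ∈ (extChartAt 𝓘(ℝ, E) x₀).target) :
    mderiv E E (extChartAt 𝓘(ℝ, E) x₀).symm y (Y.inChart x₀ y) =
      Y ((extChartAt 𝓘(ℝ, E) x₀).symm y) := by
  have h := mderiv_extChartAt_symm_comp ((extChartAt 𝓘(ℝ, E) x₀).map_target hy)
  rw [(extChartAt 𝓘(ℝ, E) x₀).right_inv hy] at h
  exact congrArg (fun L : E →L[ℝ] E => L (Y ((extChartAt 𝓘(ℝ, E) x₀).symm y))) h

/-- Over the domain of the chart at `x₀`, the tangent bundle trivialization at `x₀` acts on fibres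
as the chart derivative. -/
theorem VField.IsSmooth.contDiffAt_inChart {Y : VField E M} (hY : Y.IsSmooth) {x₀ : M} {y : E}
    (hy : y ∈ (extChartAt 𝓘(ℝ, E) x₀).target) : ContDiffAt ℝ ∞ (Y.inChart x₀) y := by
  have : IsManifold 𝓘(ℝ, E) 1 M := IsManifold.of_le (n := ∞) (by exact_mod_cast le_top)
  let e := trivializationAt E (TangentSpace 𝓘(ℝ, E) (M := M)) x₀
  have hsrc : (extChartAt 𝓘(ℝ, E) x₀).symm y ∈ (chartAt E x₀).source := by
    simpa using (extChartAt 𝓘(ℝ, E) x₀).map_target hy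
  have h1 := (e.contMDiffAt_section_iff (IB := 𝓘(ℝ, E)) (n := ∞) (s := Y)
    (x₀ := (extChartAt 𝓘(ℝ, E) x₀).symm y) (by simpa [e] using hsrc)).1 (hY _)
  have h2 : ContMDiffAt 𝓘(ℝ, E) 𝓘(ℝ, E) ∞
      (fun z => (e ⟨(extChartAt 𝓘(ℝ, E) x₀).symm z, Y ((extChartAt 𝓘(ℝ, E) x₀).symm z)⟩).2) y :=
    ContMDiffAt.comp (g := fun x => (e ⟨x, Y x⟩).2) y h1 (contMDiffAt_extChartAt_symm hy)
  refine h2.contDiffAt.congr_of_eventuallyEq ?_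
  filter_upwards [(isOpen_extChartAt_target (I := 𝓘(ℝ, E)) x₀).mem_nhds hy] with z hz
  have hz' : (extChartAt 𝓘(ℝ, E) x₀).symm z ∈ (chartAt E x₀).source := by
    simpa using (extChartAt 𝓘(ℝ, E) x₀).map_target hz
  have h3 := TangentBundle.continuousLinearMapAt_trivializationAt (I := 𝓘(ℝ, E)) hz'
  have h4 := congrArg (fun L : E →L[ℝ] E => L (Y ((extChartAt 𝓘(ℝ, E) x₀).symm z))) h3
  refine Eq.trans h4.symm ?_
  exact congrFun (e.coe_linearMapAt_of_mem (R := ℝ) (by simpa [e] using hz')) _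

/-- The Lie bracket of vector fields, computed in a chart. -/
theorem mlieBracket_eq (Y Z : VField E M) (x : M) :
    VectorField.mlieBracket 𝓘(ℝ, E) Y Z x =
      mderiv E E (extChartAt 𝓘(ℝ, E) x).symm (extChartAt 𝓘(ℝ, E) x x)
        (VectorField.lieBracket ℝ (Y.inChart x) (Z.inChart x) (extChartAt 𝓘(ℝ, E) x x)) := by
  have hx := mem_extChartAt_source (I := 𝓘(ℝ, E)) x
  have h1 : ∀ y ∈ (extChartAt 𝓘(ℝ, E) x).target,
      (mderiv E E (extChartAt 𝓘(ℝ, E) x).symm y).comp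
        (mderiv E E (extChartAt 𝓘(ℝ, E) x) ((extChartAt 𝓘(ℝ, E) x).symm y)) =
      ContinuousLinearMap.id ℝ E := by
    intro y hy
    have h := mderiv_extChartAt_symm_comp ((extChartAt 𝓘(ℝ, E) x).map_target hy)
    rwa [(extChartAt 𝓘(ℝ, E) x).right_inv hy] at h
  have h2 : ∀ Y : VField E M, VectorField.mpullbackWithin 𝓘(ℝ, E) 𝓘(ℝ, E)
      (extChartAt 𝓘(ℝ, E) x).symm Y (Set.range 𝓘(ℝ, E)) =ᶠ[𝓝 (extChartAt 𝓘(ℝ, E) x x)]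
      Y.inChart x := by
    intro Y
    filter_upwards [extChartAt_target_mem_nhds (I := 𝓘(ℝ, E)) x] with y hy
    have h3 : (mderiv E E (extChartAt 𝓘(ℝ, E) x).symm y).inverse =
        mderiv E E (extChartAt 𝓘(ℝ, E) x) ((extChartAt 𝓘(ℝ, E) x).symm y) :=
      ContinuousLinearMap.inverse_eq (h1 y hy) (mderiv_extChartAt_comp hy)
    rw [VectorField.mpullbackWithin, VField.inChart, ← h3, modelWithCornersSelf_coe, Set.range_id,
      mfderivWithin_univ]
    rfl
  have h4 : (mderiv E E (extChartAt 𝓘(ℝ, E) x) x).inverse =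
      mderiv E E (extChartAt 𝓘(ℝ, E) x).symm (extChartAt 𝓘(ℝ, E) x x) := by
    have h := mderiv_extChartAt_comp (mem_extChartAt_target (I := 𝓘(ℝ, E)) x)
    rw [extChartAt_to_inv] at h
    exact ContinuousLinearMap.inverse_eq h (mderiv_extChartAt_symm_comp hx)
  have h5 : ∀ V W : E → E, VectorField.lieBracketWithin ℝ V W
      ((extChartAt 𝓘(ℝ, E) x).symm ⁻¹' Set.univ ∩ Set.range 𝓘(ℝ, E)) (extChartAt 𝓘(ℝ, E) x x) =
      VectorField.lieBracket ℝ V W (extChartAt 𝓘(ℝ, E) x x) := by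
    intro V W
    rw [← VectorField.lieBracketWithin_univ]
    simp
  rw [← h4, ← (h2 Y).lieBracket_vectorField_eq (h2 Z)]
  exact congrArg (mderiv E E (extChartAt 𝓘(ℝ, E) x) x).inverse (h5 _ _)

theorem VField.IsSmooth.mlieBracket [FiniteDimensional ℝ E] {Y Z : VField E M} (hY : Y.IsSmooth)
    (hZ : Z.IsSmooth) :
    VField.IsSmooth (E := E) (M := M) (VectorField.mlieBracket 𝓘(ℝ, E) Y Z) := by
  have : CompleteSpace E := FiniteDimensional.complete ℝ E
  have : IsManifold 𝓘(ℝ, E) (minSmoothness ℝ 3) M := IsManifold.of_le (n := ∞) (by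
    rw [minSmoothness_of_isRCLikeNormedField]
    exact WithTop.coe_le_coe.2 le_top)
  have : IsManifold 𝓘(ℝ, E) (((⊤ : ℕ∞) : WithTop ℕ∞) + 1) M := ‹IsManifold 𝓘(ℝ, E) ∞ M›
  exact ContDiff.mlieBracket_vectorField (m := ⊤) (n := ⊤) hY hZ (by
    rw [minSmoothness_of_isRCLikeNormedField]
    exact le_rfl)

variable (E M) in
/-- The space of smooth vector fields. -/
def smoothFields : Submodule ℝ (VField E M) where
  carrier := {Y | Y.IsSmooth}
  add_mem' hY hZ := ContMDiff.add_section hY hZ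
  zero_mem' := Bundle.contMDiff_zeroSection ℝ (TangentSpace 𝓘(ℝ, E) (M := M))
  smul_mem' a _ hY := ContMDiff.const_smul_section (a := a) hY

theorem isLieAlgebraOfFields_smoothFields [FiniteDimensional ℝ E] :
    IsLieAlgebraOfFields (smoothFields E M) :=
  ⟨fun _ hY => hY, fun _ hY _ hZ => VField.IsSmooth.mlieBracket hY hZ⟩

theorem IsSmoothTimeDependent.isSmooth {X : ℝ → VField E M} (hX : IsSmoothTimeDependent X)
    (t : ℝ) : (X t).IsSmooth :=
  ContMDiff.comp (g := fun p : ℝ × M => (⟨p.2, X p.1 p.2⟩ : TangentBundle 𝓘(ℝ, E) M)) hX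
    (contMDiff_const.prodMk contMDiff_id)

theorem smallestLieAlgebra_le {X : ℝ → VField E M} {W : Submodule ℝ (VField E M)}
    (hW : IsLieAlgebraOfFields W) (hX : ∀ t, X t ∈ W) : smallestLieAlgebra X ≤ W :=
  sInf_le ⟨hW, hX⟩

theorem mem_smallestLieAlgebra (X : ℝ → VField E M) (t : ℝ) : X t ∈ smallestLieAlgebra X :=
  Submodule.mem_sInf.2 fun _ hW => hW.2 t

/-- Closure under brackets passes to intersections. Smoothness needs a member in the intersected
family, namely the Lie algebra of all smooth fields, since an empty infimum would be the whole
space. -/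
theorem isLieAlgebraOfFields_smallestLieAlgebra [FiniteDimensional ℝ E] {X : ℝ → VField E M}
    (hX : ∀ t, (X t).IsSmooth) : IsLieAlgebraOfFields (smallestLieAlgebra X) := by
  refine ⟨fun Y hY => smallestLieAlgebra_le isLieAlgebraOfFields_smoothFields hX hY,
    fun Y hY Z hZ => Submodule.mem_sInf.2 fun W hW => ?_⟩
  exact hW.1.2 Y (Submodule.mem_sInf.1 hY W hW) Z (Submodule.mem_sInf.1 hZ W hW)

end LocalField

/-! ### Related vector fields -/

section Related

variable {E : Type*} [NormedAddCommGroup E] [NormedSpace ℝ E]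
  {S : Type*} [NormedAddCommGroup S] [NormedSpace ℝ S]
  {N : Type*} [TopologicalSpace N] [ChartedSpace E N]
  {Q : Type*} [TopologicalSpace Q] [ChartedSpace S Q]

/-- The vector fields `Y` and `Y'` are related by `p`, i.e. `T p ∘ Y = Y' ∘ p`. -/
def VField.IsRelated (p : N → Q) (Y : VField E N) (Y' : VField S Q) : Prop :=
  ∀ x, mderiv E S p x (Y x) = Y' (p x)

theorem VField.IsRelated.unique {p : N → Q} (hsurj : Function.Surjective p) {Y : VField E N}
    {Y' Y'' : VField S Q} (h' : Y.IsRelated p Y') (h'' : Y.IsRelated p Y'') : Y' = Y'' := by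
  funext q
  obtain ⟨x, rfl⟩ := hsurj q
  exact (h' x).symm.trans (h'' x)

/-- The projection of vector fields along `p`, computed at the points `s q`. -/
def pushField (p : N → Q) (s : Q → N) : VField E N →ₗ[ℝ] VField S Q where
  toFun Y q := mderiv E S p (s q) (Y (s q))
  map_add' Y Z := funext fun q => map_add (mderiv E S p (s q)) (Y (s q)) (Z (s q))
  map_smul' a Y := funext fun q => map_smul (mderiv E S p (s q)) a (Y (s q))

variable [IsManifold 𝓘(ℝ, E) ∞ N] [IsManifold 𝓘(ℝ, S) ∞ Q] {p : N → Q}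

/-- The Lie bracket of related vector fields. -/
theorem VField.IsRelated.mlieBracket (hp : ContMDiff 𝓘(ℝ, E) 𝓘(ℝ, S) ∞ p) {Y Z : VField E N}
    {Y' Z' : VField S Q} (hY : Y.IsSmooth) (hZ : Z.IsSmooth) (hY' : Y'.IsSmooth)
    (hZ' : Z'.IsSmooth) (hYY' : Y.IsRelated p Y') (hZZ' : Z.IsRelated p Z') :
    VField.IsRelated (E := E) (S := S) p (VectorField.mlieBracket 𝓘(ℝ, E) Y Z)
      (VectorField.mlieBracket 𝓘(ℝ, S) Y' Z') := by
  intro x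
  have hx := mem_extChartAt_target (I := 𝓘(ℝ, E)) x
  have hpx := mem_extChartAt_source (I := 𝓘(ℝ, S)) (p x)
  -- Written in charts at `x` and `p x`, the claim is the one for vector spaces; the chart
  -- derivatives only conjugate the fields and their brackets.
  let h : E → S := fun y => extChartAt 𝓘(ℝ, S) (p x) (p ((extChartAt 𝓘(ℝ, E) x).symm y))
  have hψ := fun y (hy : y ∈ (extChartAt 𝓘(ℝ, E) x).target) =>
    (contMDiffAt_extChartAt_symm hy).mdifferentiableAt (n := ∞) (by simp)
  have hpψ : ContMDiffAt 𝓘(ℝ, E) 𝓘(ℝ, S) ∞ (fun y => p ((extChartAt 𝓘(ℝ, E) x).symm y))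
      (extChartAt 𝓘(ℝ, E) x x) :=
    ContMDiffAt.comp (g := p) _ (hp _) (contMDiffAt_extChartAt_symm hx)
  have hh : ContDiffAt ℝ ∞ h (extChartAt 𝓘(ℝ, E) x x) :=
    contDiffAt_extChartAt_comp hpψ (by rwa [extChartAt_to_inv])
  have hsrc : ∀ᶠ y in 𝓝 (extChartAt 𝓘(ℝ, E) x x), y ∈ (extChartAt 𝓘(ℝ, E) x).target ∧
      p ((extChartAt 𝓘(ℝ, E) x).symm y) ∈ (extChartAt 𝓘(ℝ, S) (p x)).source :=
    Filter.Eventually.and (extChartAt_target_mem_nhds (I := 𝓘(ℝ, E)) x) (hpψ.continuousAt.eventually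
      ((isOpen_extChartAt_source (I := 𝓘(ℝ, S)) (p x)).mem_nhds (by beta_reduce; rwa
          [extChartAt_to_inv])))
  have hder : ∀ y ∈ (extChartAt 𝓘(ℝ, E) x).target,
      p ((extChartAt 𝓘(ℝ, E) x).symm y) ∈ (extChartAt 𝓘(ℝ, S) (p x)).source → ∀ v,
      fderiv ℝ h y v = mderiv S S (extChartAt 𝓘(ℝ, S) (p x)) (p ((extChartAt 𝓘(ℝ, E) x).symm y))
        (mderiv E S p ((extChartAt 𝓘(ℝ, E) x).symm y)
          (mderiv E E (extChartAt 𝓘(ℝ, E) x).symm y v)) := by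
    intro y hy hy' v
    have e1 := mderiv_comp (E := E) (E' := E) (E'' := S) (g := p)
      (f := (extChartAt 𝓘(ℝ, E) x).symm) (x := y) (hp.mdifferentiable (by simp) _) (hψ y hy)
    have e2 := mderiv_comp (E := E) (E' := S) (E'' := S) (g := extChartAt 𝓘(ℝ, S) (p x))
      (f := fun y => p ((extChartAt 𝓘(ℝ, E) x).symm y)) (x := y)
      ((contMDiffAt_extChartAt_of_mem hy').mdifferentiableAt (n := ∞) (by simp))
      (MDifferentiableAt.comp (g := p) y (hp.mdifferentiable (by simp) _) (hψ y hy))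
    rw [mderiv_eq_fderiv, e1] at e2
    exact congrArg (fun L : E →L[ℝ] S => L v) e2
  have hrel : ∀ {Y : VField E N} {Y' : VField S Q}, Y.IsRelated p Y' →
      ∀ᶠ y in 𝓝 (extChartAt 𝓘(ℝ, E) x x),
        fderiv ℝ h y (Y.inChart x y) = Y'.inChart (p x) (h y) := by
    intro Y Y' hYY'
    filter_upwards [hsrc] with y hy
    rw [hder y hy.1 hy.2, Y.mderiv_inChart hy.1]
    erw [hYY']
    exact congrArg (fun q => mderiv S S (extChartAt 𝓘(ℝ, S) (p x)) q (Y' q))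
      ((extChartAt 𝓘(ℝ, S) (p x)).left_inv hy.2).symm
  have hhx : h (extChartAt 𝓘(ℝ, E) x x) = extChartAt 𝓘(ℝ, S) (p x) (p x) := by
    simp only [h, extChartAt_to_inv]
  have ht : h (extChartAt 𝓘(ℝ, E) x x) ∈ (extChartAt 𝓘(ℝ, S) (p x)).target := by
    rw [hhx]
    exact mem_extChartAt_target (I := 𝓘(ℝ, S)) (p x)
  have key := fderiv_lieBracket_of_related hh
    ((hY.contDiffAt_inChart hx).differentiableAt (by simp))
    ((hZ.contDiffAt_inChart hx).differentiableAt (by simp))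
    ((hY'.contDiffAt_inChart ht).differentiableAt (by simp))
    ((hZ'.contDiffAt_inChart ht).differentiableAt (by simp)) (hrel hYY') (hrel hZZ')
  rw [hder _ hx (by rwa [extChartAt_to_inv])] at key
  erw [mlieBracket_eq, mlieBracket_eq]
  rw [← hhx, ← key, hhx]
  have e3 := mderiv_extChartAt_symm_comp hpx
  rw [extChartAt_to_inv]
  exact (congrArg (fun L : S →L[ℝ] S => L _) e3).symm

/-- A `t`-dependent vector field related to a smooth one is smooth. -/
theorem isSmoothTimeDependent_of_isRelated (hsec : HasLocalSections E S p)
    (hp : ContMDiff 𝓘(ℝ, E) 𝓘(ℝ, S) ∞ p) (hsurj : Function.Surjective p)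
    {X : ℝ → VField E N} {X' : ℝ → VField S Q} (hX : IsSmoothTimeDependent X)
    (h : ∀ t, (X t).IsRelated p (X' t)) : IsSmoothTimeDependent X' := by
  rintro ⟨t, q⟩
  obtain ⟨y, rfl⟩ := hsurj q
  obtain ⟨τ, h1, h2, h3⟩ := hsec y
  have e1 : ContMDiff 𝓘(ℝ, E).tangent 𝓘(ℝ, S).tangent ∞
      (tangentMap 𝓘(ℝ, E) 𝓘(ℝ, S) p) := hp.contMDiff_tangentMap (by simp)
  -- Near `p y` the field `X'` is the composite of `(t, q) ↦ (t, τ q)`, `X` and the tangent map of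
  -- `p`.
  have e2 : ContMDiffAt (𝓘(ℝ, ℝ).prod 𝓘(ℝ, S)) (𝓘(ℝ, ℝ).prod 𝓘(ℝ, E)) ∞
      (fun z : ℝ × Q => (z.1, τ z.2)) (t, p y) :=
    contMDiffAt_fst.prodMk (ContMDiffAt.comp (g := τ) _ h2 contMDiffAt_snd)
  have e3 := ContMDiffAt.comp (g := tangentMap 𝓘(ℝ, E) 𝓘(ℝ, S) p) (t, p y) (e1 _)
    (ContMDiffAt.comp (g := fun z : ℝ × N => (⟨z.2, X z.1 z.2⟩ : TangentBundle 𝓘(ℝ, E) N)) (t, p y)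
      (hX _) e2)
  refine e3.congr_of_eventuallyEq ?_
  filter_upwards [(continuous_snd (X := ℝ) (Y := Q)).continuousAt.eventually h3] with z hz
  have e4 : mderiv E S p (τ z.2) (X z.1 (τ z.2)) = X' z.1 (p (τ z.2)) := h z.1 (τ z.2)
  change (⟨z.2, X' z.1 z.2⟩ : TangentBundle 𝓘(ℝ, S) Q) =
    ⟨p (τ z.2), mderiv E S p (τ z.2) (X z.1 (τ z.2))⟩
  rw [e4, hz]

theorem VField.IsRelated.isSmooth (hsec : HasLocalSections E S p)
    (hp : ContMDiff 𝓘(ℝ, E) 𝓘(ℝ, S) ∞ p) (hsurj : Function.Surjective p)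
    {Y : VField E N} {Y' : VField S Q} (hY : Y.IsSmooth) (h : Y.IsRelated p Y') : Y'.IsSmooth :=
  (isSmoothTimeDependent_of_isRelated (X := fun _ => Y) (X' := fun _ => Y') hsec hp hsurj
    (ContMDiff.comp (g := fun x => (⟨x, Y x⟩ : TangentBundle 𝓘(ℝ, E) N)) hY contMDiff_snd)
    fun _ => h).isSmooth 0

/-- If all elements of the smallest Lie algebra of `X` are projectable then the smallest Lie algebra
of the projection of `X` consists of projections of elements of the smallest Lie algebra of `X`. -/
theorem smallestLieAlgebra_le_map [FiniteDimensional ℝ E] {P : VField E N →ₗ[ℝ] VField S Q}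
    (hsec : HasLocalSections E S p)
    (hp : ContMDiff 𝓘(ℝ, E) 𝓘(ℝ, S) ∞ p) (hsurj : Function.Surjective p)
    {X : ℝ → VField E N} (hX : ∀ t, (X t).IsSmooth)
    (hP : ∀ Y ∈ smallestLieAlgebra X, Y.IsRelated p (P Y)) :
    smallestLieAlgebra (fun t => P (X t)) ≤ (smallestLieAlgebra X).map P := by
  have hV := isLieAlgebraOfFields_smallestLieAlgebra hX
  -- By minimality it is enough that the image of `V^X` is itself a Lie algebra of fields. The
  -- bracket of two projections is the projection of the bracket, both being related to it through
  -- the surjective `p`.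
  refine smallestLieAlgebra_le ⟨?_, ?_⟩ fun t => ⟨X t, mem_smallestLieAlgebra X t, rfl⟩
  · rintro _ ⟨Y, hY, rfl⟩
    exact (hP Y hY).isSmooth hsec hp hsurj (hV.1 Y hY)
  · rintro _ ⟨Y, hY, rfl⟩ _ ⟨Z, hZ, rfl⟩
    refine ⟨_, hV.2 Y hY Z hZ, (hP _ (hV.2 Y hY Z hZ)).unique hsurj ?_⟩
    exact VField.IsRelated.mlieBracket hp (hV.1 Y hY) (hV.1 Z hZ)
      ((hP Y hY).isSmooth hsec hp hsurj (hV.1 Y hY))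
      ((hP Z hZ).isSmooth hsec hp hsurj (hV.1 Z hZ)) (hP Y hY) (hP Z hZ)

end Related

/-! ### Fundamental fields in charts -/

section Generator

variable {E : Type*} [NormedAddCommGroup E] [NormedSpace ℝ E]
  {N : Type*} [TopologicalSpace N] [ChartedSpace E N]
  {F : Type*} [NormedAddCommGroup F] [NormedSpace ℝ F]
  {G : Type*} [TopologicalSpace G] [ChartedSpace F G] [Group G] [MulAction G N]

/-- The fundamental field of `ζ` in the chart at `x`. -/
def generator (G : Type*) [TopologicalSpace G] [ChartedSpace F G] [Group G] [MulAction G N]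
    (ζ : F) (x : N) (y : E) : E :=
  fderiv ℝ (fun a => extChartAt 𝓘(ℝ, E) x (chartAction E F (1 : G) x a))
    (extChartAt 𝓘(ℝ, F) (1 : G) 1, y) (mderiv F F (extChartAt 𝓘(ℝ, F) (1 : G)) 1 ζ, 0)

theorem chartAction_one (x : N) (y : E) :
    chartAction E F (1 : G) x (extChartAt 𝓘(ℝ, F) (1 : G) 1, y) =
      (extChartAt 𝓘(ℝ, E) x).symm y := by
  rw [chartAction, extChartAt_to_inv, one_smul]

variable [IsManifold 𝓘(ℝ, E) ∞ N] [IsManifold 𝓘(ℝ, F) ∞ G]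
  [ContMDiffSMul 𝓘(ℝ, F) 𝓘(ℝ, E) ∞ G N]

theorem contDiffAt_extChartAt_chartAction {x : N} {y : E}
    (hy : y ∈ (extChartAt 𝓘(ℝ, E) x).target) :
    ContDiffAt ℝ ∞ (fun a => extChartAt 𝓘(ℝ, E) x (chartAction E F (1 : G) x a))
      (extChartAt 𝓘(ℝ, F) (1 : G) 1, y) := by
  refine contDiffAt_extChartAt_comp
    (contMDiffAt_chartAction F (mem_extChartAt_target (I := 𝓘(ℝ, F)) (1 : G)) hy) ?_
  rw [chartAction_one]
  exact (extChartAt 𝓘(ℝ, E) x).map_target hy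

theorem contDiffAt_generator (ζ : F) {x : N} {y : E} (hy : y ∈ (extChartAt 𝓘(ℝ, E) x).target) :
    ContDiffAt ℝ ∞ (generator G ζ x) y := by
  have h1 := (contDiffAt_extChartAt_chartAction (F := F) (G := G) hy).fderiv_right (m := ∞)
      (by simp)
  have h2 : ContDiffAt ℝ ∞ (fun y : E => (extChartAt 𝓘(ℝ, F) (1 : G) 1, y)) y :=
    contDiffAt_const.prodMk contDiffAt_id
  exact (ContDiffAt.comp (g := fderiv ℝ _) y h1 h2).clm_apply contDiffAt_const

theorem fderiv_extChartAt_chartAction {x : N} {b : F}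
    (hb : b ∈ (extChartAt 𝓘(ℝ, F) (1 : G)).target) {y : E}
    (hy : y ∈ (extChartAt 𝓘(ℝ, E) x).target)
    (hs : chartAction E F (1 : G) x (b, y) ∈ (extChartAt 𝓘(ℝ, E) x).source) (v : F × E) :
    fderiv ℝ (fun a => extChartAt 𝓘(ℝ, E) x (chartAction E F (1 : G) x a)) (b, y) v =
      mderiv E E (extChartAt 𝓘(ℝ, E) x) (chartAction E F (1 : G) x (b, y))
        (mderiv (F × E) E (chartAction E F (1 : G) x) (b, y) v) := by
  have h1 := mderiv_comp (E := F × E) (E' := E) (E'' := E) (g := extChartAt 𝓘(ℝ, E) x)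
    (f := chartAction E F (1 : G) x) (x := (b, y))
    ((contMDiffAt_extChartAt_of_mem hs).mdifferentiableAt (n := ∞) (by simp))
    ((contMDiffAt_chartAction F (a := (b, y)) hb hy).mdifferentiableAt (by simp))
  erw [mderiv_eq_fderiv] at h1
  exact congrArg (fun L : F × E →L[ℝ] E => L v) h1

theorem mderiv_generator (ζ : F) {x : N} {y : E} (hy : y ∈ (extChartAt 𝓘(ℝ, E) x).target) :
    mderiv E E (extChartAt 𝓘(ℝ, E) x).symm y (generator G ζ x y) =
      mderiv F E (fun g : G => g • (extChartAt 𝓘(ℝ, E) x).symm y) 1 ζ := by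
  have h1 := mem_extChartAt_target (I := 𝓘(ℝ, F)) (1 : G)
  have hs : chartAction E F (1 : G) x (extChartAt 𝓘(ℝ, F) (1 : G) 1, y) ∈
      (extChartAt 𝓘(ℝ, E) x).source := by
    rw [chartAction_one]
    exact (extChartAt 𝓘(ℝ, E) x).map_target hy
  rw [generator, fderiv_extChartAt_chartAction h1 hy hs, mderiv_chartAction_inl F h1 hy,
    chartAction_one, extChartAt_to_inv]
  have h2 := mderiv_extChartAt_symm_comp ((extChartAt 𝓘(ℝ, E) x).map_target hy)
  rw [(extChartAt 𝓘(ℝ, E) x).right_inv hy] at h2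
  have h3 := mderiv_extChartAt_symm_comp (mem_extChartAt_source (I := 𝓘(ℝ, F)) (1 : G))
  refine (congrArg (fun L : E →L[ℝ] E => L _) h2).trans ?_
  exact congrArg (mderiv F E (fun g : G => g • (extChartAt 𝓘(ℝ, E) x).symm y) 1)
    (congrArg (fun L : F →L[ℝ] F => L ζ) h3)

/-- Invariant fields commute with the fundamental fields. -/
theorem fderiv_generator_inChart {Y : VField E N} (hY : Y.IsSmooth) (hinv : IsInvariantField G Y)
    (ζ : F) {x : N} {y : E} (hy : y ∈ (extChartAt 𝓘(ℝ, E) x).target) :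
    fderiv ℝ (generator G ζ x) y (Y.inChart x y) =
      fderiv ℝ (Y.inChart x) y (generator G ζ x y) := by
  have h1 := mem_extChartAt_target (I := 𝓘(ℝ, F)) (1 : G)
  have hH := contDiffAt_extChartAt_chartAction (F := F) (G := G) hy
  refine fderiv_generator_eq (mderiv F F (extChartAt 𝓘(ℝ, F) (1 : G)) 1 ζ) hH ?_
    ((hY.contDiffAt_inChart hy).differentiableAt (by simp)) ?_
  · rw [chartAction_one, (extChartAt 𝓘(ℝ, E) x).right_inv hy]
  have hs : ∀ᶠ b in 𝓝 (extChartAt 𝓘(ℝ, F) (1 : G) 1),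
      chartAction E F (1 : G) x (b, y) ∈ (extChartAt 𝓘(ℝ, E) x).source := by
    have hc := (contMDiffAt_chartAction F (E := E) (g := (1 : G)) (x := x)
      (a := (extChartAt 𝓘(ℝ, F) (1 : G) 1, y)) h1 hy).continuousAt.comp
        (f := fun b : F => (b, y)) (by fun_prop)
    refine hc.eventually ((isOpen_extChartAt_source (I := 𝓘(ℝ, E)) x).mem_nhds ?_)
    change chartAction E F (1 : G) x (extChartAt 𝓘(ℝ, F) (1 : G) 1, y) ∈ _
    rw [chartAction_one]
    exact (extChartAt 𝓘(ℝ, E) x).map_target hy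
  filter_upwards [hs, extChartAt_target_mem_nhds (I := 𝓘(ℝ, F)) (1 : G)] with b hb hb'
  rw [fderiv_extChartAt_chartAction hb' hy hb, mderiv_chartAction_inr F hb' hy,
    Y.mderiv_inChart hy, VField.inChart, (extChartAt 𝓘(ℝ, E) x).left_inv hb]
  exact congrArg (mderiv E E (extChartAt 𝓘(ℝ, E) x) (chartAction E F (1 : G) x (b, y)))
    (hinv _ _)

end Generator

/-! ### Contractions in charts -/

section ContractField

variable {E : Type*} [NormedAddCommGroup E] [NormedSpace ℝ E]
  {N : Type*} [TopologicalSpace N] [ChartedSpace E N]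

theorem DForm.val_contractField {k : ℕ} (Y : VField E N) (β : DForm E N (k + 1)) (x : N)
    (v : Fin k → E) : (β.contractField Y).val x v = β.val x (Matrix.vecCons (Y x) v) := rfl

theorem DForm.inChart_apply {k : ℕ} (β : DForm E N k) (x : N) (y : E) (v : Fin k → E) :
    β.inChart x y v = β.val ((extChartAt 𝓘(ℝ, E) x).symm y)
      (fun i => mderiv E E (extChartAt 𝓘(ℝ, E) x).symm y (v i)) := rfl

theorem VField.IsRelated.pullback_contractField {S : Type*} [NormedAddCommGroup S] [NormedSpace ℝ S]
    {Q : Type*} [TopologicalSpace Q] [ChartedSpace S Q] {p : N → Q} {Y : VField E N}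
    {Y' : VField S Q} (h : Y.IsRelated p Y') {k : ℕ} (β : DForm S Q (k + 1)) :
    DForm.pullback p (β.contractField Y') = DForm.contractField Y (DForm.pullback (E := E) p β)
        := by
  refine DForm.ext_val fun x => ?_
  ext v
  change β.val (p x) (Matrix.vecCons (Y' (p x)) fun i => mderiv E S p x (v i)) =
    β.val (p x) (fun i => mderiv E S p x ((Matrix.vecCons (Y x) v : Fin (k + 1) → E) i))
  rw [← h x]
  congr 1
  funext i
  refine Fin.cases rfl (fun i => rfl) i

variable [IsManifold 𝓘(ℝ, E) ∞ N]

theorem DForm.inChart_contractField {k : ℕ} (Y : VField E N) (β : DForm E N (k + 1)) {x : N}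
    {y : E} (hy : y ∈ (extChartAt 𝓘(ℝ, E) x).target) :
    (β.contractField Y).inChart x y = (β.inChart x y).curryLeft (Y.inChart x y) := by
  ext v
  rw [DForm.inChart_apply, DForm.val_contractField, ContinuousAlternatingMap.curryLeft_apply_apply,
    DForm.inChart_apply, ← Y.mderiv_inChart hy]
  congr 1
  funext i
  refine Fin.cases rfl (fun i => rfl) i

theorem DForm.IsSmooth.contractField {k : ℕ} {Y : VField E N} {β : DForm E N (k + 1)}
    (hβ : β.IsSmooth) (hY : Y.IsSmooth) : (β.contractField Y).IsSmooth := by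
  intro x y hy
  refine ContDiffAt.contDiffWithinAt ?_
  refine (contDiffAt_curryLeft (hβ.contDiffAt_inChart hy)
    (hY.contDiffAt_inChart hy)).congr_of_eventuallyEq ?_
  filter_upwards [(isOpen_extChartAt_target (I := 𝓘(ℝ, E)) x).mem_nhds hy] with z hz
  exact β.inChart_contractField Y hz

end ContractField

/-! ### Contraction with fundamental fields: kernel, smoothness and closedness -/

section Contraction

variable {E : Type*} [NormedAddCommGroup E] [NormedSpace ℝ E]
  {N : Type*} [TopologicalSpace N] [ChartedSpace E N]
  {F : Type*} [NormedAddCommGroup F] [NormedSpace ℝ F]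
  {G : Type*} [TopologicalSpace G] [ChartedSpace F G] [Group G] [MulAction G N]

/-- `β` is the contraction of `Θ` with `c` times the wedge product of the fundamental fields of
`b`. -/
def IsContraction {r k : ℕ} (G : Type*) [TopologicalSpace G] [ChartedSpace F G] [Group G]
    [MulAction G N] (c : ℝ) (b : Fin r → F) (Θ : DForm E N (r + k)) (β : DForm E N k) : Prop :=
  ∀ (x : N) (v : Fin k → E), β.val x v =
    c * Θ.val x (Fin.append (fun i => mderiv F E (fun g : G => g • x) 1 (b i)) v)

variable {r k : ℕ} {c : ℝ} {b : Fin r → F}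

/-- The contraction is annihilated by the vectors tangent to the orbits. -/
theorem IsContraction.val_eq_zero {b : Module.Basis (Fin r) ℝ F} {Θ : DForm E N (r + k)}
    {β : DForm E N k} (h : IsContraction G c b Θ β) {x : N} {v : Fin k → E} {i : Fin k} {ζ : F}
    (hζ : mderiv F E (fun g : G => g • x) 1 ζ = v i) : β.val x v = 0 := by
  rw [h, mul_eq_zero]
  -- The entry `v i` is a combination of the first `r` entries, since the basis vectors span the Lie
  -- algebra.
  refine Or.inr ((Θ.val x).toAlternatingMap.map_linearDependent _ fun hli => ?_)
  refine hli.notMem_span_image (s := Set.range (Fin.castAdd k)) (x := Fin.natAdd r i) ?_ ?_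
  · rintro ⟨j, hj⟩
    have := congrArg Fin.val hj
    simp only [Fin.val_castAdd, Fin.val_natAdd] at this
    omega
  · rw [Fin.append_right, ← hζ, ← b.sum_repr ζ, map_sum]
    refine Submodule.sum_mem _ fun j _ => ?_
    rw [map_smul]
    refine Submodule.smul_mem _ _ (Submodule.subset_span ⟨_, ⟨j, rfl⟩, ?_⟩)
    rw [Fin.append_left]

/-- Only the vectors tangent to the orbits annihilate the contraction of an
`(r + 1)`-nondegenerate form. -/
theorem IsContraction.exists_eq {b : Module.Basis (Fin r) ℝ F} {Θ : DForm E N (r + (k + 1))}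
    {β : DForm E N (k + 1)} (h : IsContraction G c b Θ β) (hc : c ≠ 0) {x : N}
    (hΘ : IsNondegenerate (r + 1) (Θ x))
    (hinj : Function.Injective (mderiv F E (fun g : G => g • x) 1)) {v : E}
    (hv : ∀ z : Fin k → E, β.val x (Matrix.vecCons v z) = 0) :
    ∃ ζ, mderiv F E (fun g : G => g • x) 1 ζ = v := by
  have h1 : LinearIndependent ℝ fun i => mderiv F E (fun g : G => g • x) 1 (b i) :=
    b.linearIndependent.map' (mderiv F E (fun g : G => g • x) 1).toLinearMap
      (LinearMap.ker_eq_bot.2 hinj)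
  have h2 : v ∈ Submodule.span ℝ
      (Set.range fun i => mderiv F E (fun g : G => g • x) 1 (b i)) := by
    have hΘx : IsNondegenerate (r + 1) (Θ.val x) := hΘ
    refine mem_span_of_isNondegenerate hΘx h1 fun z => ?_
    have := hv z
    rw [h, mul_eq_zero] at this
    exact this.resolve_left hc
  have h3 : Submodule.span ℝ (Set.range fun i => mderiv F E (fun g : G => g • x) 1 (b i)) ≤
      (mderiv F E (fun g : G => g • x) 1).toLinearMap.range := by
    rw [Submodule.span_le]
    rintro _ ⟨i, rfl⟩
    exact ⟨b i, rfl⟩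
  exact h3 h2

/-- Invariant fields are projectable. -/
theorem IsInvariantField.isRelated_pushField {G : Type*} [Group G] [MulAction G N] {S : Type*}
    [NormedAddCommGroup S] [NormedSpace ℝ S]
    {Q : Type*} [TopologicalSpace Q] [ChartedSpace S Q] {p : N → Q} {s : Q → N}
    (hp : ContMDiff 𝓘(ℝ, E) 𝓘(ℝ, S) ∞ p)
    (hsmul : ∀ g : G, ContMDiff 𝓘(ℝ, E) 𝓘(ℝ, E) ∞ (fun x : N => g • x))
    (hinv : ∀ (g : G) (x : N), p (g • x) = p x) (hs : ∀ x, ∃ g : G, g • s (p x) = x)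
    {Y : VField E N} (hY : IsInvariantField G Y) : Y.IsRelated p (pushField (S := S) p s Y) := by
  intro x
  -- Invariance transports the value of `Y` from the chosen point `s (p x)` to `x`, and `p` does not
  -- see the translation.
  obtain ⟨g, hg⟩ := hs x
  have e1 := mderiv_comp (E := E) (E' := E) (E'' := S) (g := p) (f := fun z : N => g • z)
    (x := s (p x)) (hp.mdifferentiable (by simp) _) ((hsmul g).mdifferentiable (by simp) _)
  have e2 : (fun z : N => p (g • z)) = p := funext fun z => hinv g z
  have e3 : mderiv E S p (g • s (p x)) (Y (g • s (p x))) =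
      mderiv E S p (s (p x)) (Y (s (p x))) := by
    rw [← hY]
    rw [e2] at e1
    exact (congrArg (fun L : E →L[ℝ] S => L (Y (s (p x)))) e1).symm
  rw [hg] at e3
  exact e3

variable [IsManifold 𝓘(ℝ, E) ∞ N] [IsManifold 𝓘(ℝ, F) ∞ G] [ContMDiffSMul 𝓘(ℝ, F) 𝓘(ℝ, E) ∞ G N]

theorem IsContraction.inChart {Θ : DForm E N (r + k)} {β : DForm E N k}
    (h : IsContraction G c b Θ β) {x : N} {y : E} (hy : y ∈ (extChartAt 𝓘(ℝ, E) x).target)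
    (v : Fin k → E) : β.inChart x y v =
      c * Θ.inChart x y (Fin.append (fun i => generator G (b i) x y) v) := by
  rw [DForm.inChart_apply, h, DForm.inChart_apply]
  congr 2
  funext i
  refine Fin.addCases (fun i => ?_) (fun i => ?_) i
  · simp only [Fin.append_left]
    exact (mderiv_generator (b i) hy).symm
  · simp only [Fin.append_right]

variable [FiniteDimensional ℝ E]

theorem IsContraction.isSmooth {Θ : DForm E N (r + k)} {β : DForm E N k}
    (h : IsContraction G c b Θ β) (hΘ : Θ.IsSmooth) : β.IsSmooth := by
  intro x y hy
  refine ContDiffAt.contDiffWithinAt (contDiffAt_of_alternating_apply fun v => ?_)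
  have h1 : ContDiffAt ℝ ∞ (fun y => c * Θ.inChart x y
      (Fin.append (fun i => generator G (b i) x y) v)) y := by
    refine contDiffAt_const.mul
        (contDiffAt_alternating_apply (hΘ.contDiffAt_inChart hy) fun i => ?_)
    refine Fin.addCases (fun i => ?_) (fun i => ?_) i
    · simpa using contDiffAt_generator (G := G) (b i) hy
    · simpa using contDiffAt_const
  refine h1.congr_of_eventuallyEq ?_
  filter_upwards [(isOpen_extChartAt_target (I := 𝓘(ℝ, E)) x).mem_nhds hy] with z hz
  exact h.inChart hz v

/-- The contraction of an invariant locally Hamiltonian field with `ι_w Θ` is closed. -/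
theorem IsContraction.isClosed_contractField {Θ : DForm E N (r + (k + 1))}
    {β : DForm E N (k + 1)} (h : IsContraction G c b Θ β) (hΘ : Θ.IsSmooth) (hdΘ : Θ.IsClosed)
    (hdβ : β.IsClosed) {Y : VField E N} (hY : Y.IsSmooth) (hinv : IsInvariantField G Y)
    (hdY : (DForm.contractField (k := r + k) Y Θ).IsClosed) : (β.contractField Y).IsClosed := by
  rw [DForm.isClosed_iff] at hdΘ hdβ hdY ⊢
  intro x
  have hx := mem_extChartAt_target (I := 𝓘(ℝ, E)) x
  have ht := extChartAt_target_mem_nhds (I := 𝓘(ℝ, E)) x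
  have h1 : (β.contractField Y).inChart x =ᶠ[𝓝 (extChartAt 𝓘(ℝ, E) x x)]
      fun y => (β.inChart x y).curryLeft (Y.inChart x y) := by
    filter_upwards [ht] with y hy
    exact β.inChart_contractField Y hy
  have h2 : (fun y => ((c • Θ.inChart x) y : E [⋀^Fin (r + k + 1)]→L[ℝ] ℝ).curryLeft
      (Y.inChart x y)) =ᶠ[𝓝 (extChartAt 𝓘(ℝ, E) x x)]
      c • (DForm.contractField (k := r + k) Y Θ).inChart x := by
    filter_upwards [ht] with y hy
    rw [Pi.smul_apply, Pi.smul_apply, DForm.inChart_contractField (k := r + k) Y Θ hy]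
    rfl
  have hΘx := (hΘ.contDiffAt_inChart hx).differentiableAt (n := ∞) (by simp)
  rw [h1.extDeriv_eq]
  -- The constant `c` is absorbed into `Θ`, so that in the chart `β` is exactly the contraction with
  -- the generators; they commute with `Y` by invariance.
  refine extDeriv_curryLeft_contraction (r := r) (k := k) (α := c • Θ.inChart x)
    (ξ := fun i => generator G (b i) x) (hΘx.const_smul c)
    (((h.isSmooth hΘ).contDiffAt_inChart hx).differentiableAt (by simp))
    (fun i => (contDiffAt_generator (b i) hx).differentiableAt (by simp))
    ((hY.contDiffAt_inChart hx).differentiableAt (by simp)) ?_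
    (fun i => fderiv_generator_inChart hY hinv (b i) hx) ?_ (hdβ x) ?_
  · filter_upwards [ht] with y hy v
    exact h.inChart hy v
  · rw [extDeriv_smul, hdΘ x, smul_zero]
  · rw [h2.extDeriv_eq, extDeriv_smul, hdY x, smul_zero]

end Contraction

end Multisymplectic

end

/-! ### The reduction theorem -/

open Multisymplectic in
theorem mainTheorem2 {n r m : ℕ}
    {N : Type*} [TopologicalSpace N] [T2Space N] [SecondCountableTopology N] [ConnectedSpace N]
    [ChartedSpace (EuclideanSpace ℝ (Fin n)) N]
    [IsManifold 𝓘(ℝ, EuclideanSpace ℝ (Fin n)) ∞ N]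
    {G : Type*} [TopologicalSpace G] [T2Space G] [SecondCountableTopology G] [ConnectedSpace G]
    [ChartedSpace (EuclideanSpace ℝ (Fin r)) G] [Group G]
    [LieGroup 𝓘(ℝ, EuclideanSpace ℝ (Fin r)) ∞ G]
    [MulAction G N]
    (Θ : Multisymplectic.DForm (EuclideanSpace ℝ (Fin n)) N (r + (m + 1)))
    (X : ℝ → Multisymplectic.VField (EuclideanSpace ℝ (Fin n)) N)
    (w : ⋀[ℝ]^r (Multisymplectic.fundamentalFields
      (EuclideanSpace ℝ (Fin n)) N (EuclideanSpace ℝ (Fin r)) G))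
    (hX : Multisymplectic.IsMultisymplecticLieSystem Θ X)
    (hΦ : Multisymplectic.IsMultisymplecticReductionScheme Θ w)
    (hsymm : ∀ Y ∈ Multisymplectic.smallestLieAlgebra X, Multisymplectic.IsInvariantField G Y) :
    ∃ _ : ChartedSpace (EuclideanSpace ℝ (Fin (n - r))) (MulAction.orbitRel.Quotient G N),
    ∃ _ : IsManifold 𝓘(ℝ, EuclideanSpace ℝ (Fin (n - r))) ∞ (MulAction.orbitRel.Quotient G N),
      Multisymplectic.IsQuotientManifold (EuclideanSpace ℝ (Fin n))
        (EuclideanSpace ℝ (Fin (n - r))) N G ∧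
      ∃ (Θ' : Multisymplectic.DForm (EuclideanSpace ℝ (Fin (n - r)))
            (MulAction.orbitRel.Quotient G N) (m + 1))
        (X' : ℝ → Multisymplectic.VField (EuclideanSpace ℝ (Fin (n - r)))
            (MulAction.orbitRel.Quotient G N)),
        (∀ Ω : Multisymplectic.DForm (EuclideanSpace ℝ (Fin (n - r)))
            (MulAction.orbitRel.Quotient G N) (m + 1),
          Multisymplectic.DForm.pullback (Multisymplectic.orbitProj G N) Ω = Θ.contractMulti w ↔
            Ω = Θ') ∧
        (∀ Y : ℝ → Multisymplectic.VField (EuclideanSpace ℝ (Fin (n - r)))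
            (MulAction.orbitRel.Quotient G N),
          Multisymplectic.ProjectsTo (Multisymplectic.orbitProj G N) X Y ↔ Y = X') ∧
        Multisymplectic.IsMultisymplecticLieSystem Θ' X' := by
  obtain ⟨x₀⟩ : Nonempty N := inferInstance
  have hact := hΦ.smooth_action
  have hproper := hΦ.proper_action
  have hfree := hΦ.free_action
  have hGman : IsManifold 𝓘(ℝ, EuclideanSpace ℝ (Fin r)) ∞ G :=
    (inferInstance : ContMDiffMul 𝓘(ℝ, EuclideanSpace ℝ (Fin r)) ∞ G).toIsManifold
  have hconst : ContinuousConstSMul G N :=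
    ⟨fun g => (contMDiff_smul_left (E := EuclideanSpace ℝ (Fin n)) (N := N)
      (EuclideanSpace ℝ (Fin r)) g).continuous⟩
  have hinj := injective_mderiv_smul_point (E := EuclideanSpace ℝ (Fin n)) (N := N)
    (EuclideanSpace ℝ (Fin r)) hfree
  -- An orbit map is an immersion, so the natural number subtraction `n - r` is not truncated.
  have hrn : r ≤ n := by
    simpa using LinearMap.finrank_le_finrank_of_injective (f := (mderiv (EuclideanSpace ℝ (Fin r))
      (EuclideanSpace ℝ (Fin n)) (fun g : G => g • x₀) 1).toLinearMap) (hinj x₀)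
  have hdim : Module.finrank ℝ (EuclideanSpace ℝ (Fin r)) +
      Module.finrank ℝ (EuclideanSpace ℝ (Fin (n - r))) =
      Module.finrank ℝ (EuclideanSpace ℝ (Fin n)) := by
    simp only [finrank_euclideanSpace_fin]
    omega
  obtain ⟨cs, im, hp, hsec⟩ := exists_quotientManifold (E := EuclideanSpace ℝ (Fin n))
    (N := N) (G := G) (EuclideanSpace ℝ (Fin r)) (EuclideanSpace ℝ (Fin (n - r))) hdim hfree
  replace hsec : HasLocalSections (EuclideanSpace ℝ (Fin n)) (EuclideanSpace ℝ (Fin (n - r)))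
    (orbitProj G N) := hsec
  have hsurj := surjective_orbitProj (G := G) (N := N)
  have hinv := orbitProj_smul (G := G) (N := N)
  refine ⟨cs, im, ⟨t2Space_quotient_mulAction_of_properSMul, ?_, ?_, hp,
    hsec.surjective_mderiv hp⟩, ?_⟩
  · exact ContinuousConstSMul.secondCountableTopology
  · exact hsurj.connectedSpace isOpenQuotientMap_orbitProj.continuous
  let b : Module.Basis (Fin r) ℝ (EuclideanSpace ℝ (Fin r)) :=
    (EuclideanSpace.basisFun (Fin r) ℝ).toBasis
  obtain ⟨c, hc, hcon⟩ := DForm.exists_val_contractMulti b hinj hΦ.ne_zero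
  have hβ : IsContraction G c b Θ (Θ.contractMulti w) := hcon Θ
  have hΘ := hΦ.multisymplectic
  have hsm := hβ.isSmooth hΘ.smooth
  have hcl := hΦ.locallyHamiltonian
  have hker : ∀ (x : N) (v : Fin (m + 1) → EuclideanSpace ℝ (Fin n)),
      (∃ i, mderiv _ (EuclideanSpace ℝ (Fin (n - r))) (orbitProj G N) x (v i) = 0) →
      (Θ.contractMulti w).val x v = 0 := by
    rintro x v ⟨i, hi⟩
    obtain ⟨ζ, hζ⟩ := exists_eq_mderiv_smul_point (F := EuclideanSpace ℝ (Fin r)) hp hsec hinv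
      hdim (hinj x) hi
    exact hβ.val_eq_zero hζ
  obtain ⟨Θ', hΘ'⟩ := (DForm.IsClosed.isBasic (F := EuclideanSpace ℝ (Fin r)) hcl hsm hp
    (fun _ _ => orbitProj_eq_iff) hker).exists_pullback_eq hsec hp hsurj
  -- Projection of fields is computed at a chosen representative of each orbit. It is linear on all
  -- fields, though meaningful only for projectable ones, so that `V^X` has a finite-dimensional
  -- image.
  let P := pushField (E := EuclideanSpace ℝ (Fin n)) (S := EuclideanSpace ℝ (Fin (n - r)))
    (orbitProj G N) Quotient.out
  have hP : ∀ Y ∈ smallestLieAlgebra X, VField.IsRelated (orbitProj G N) Y (P Y) := by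
    intro Y hY
    exact (hsymm Y hY).isRelated_pushField hp (contMDiff_smul_left (EuclideanSpace ℝ (Fin r))) hinv
      exists_smul_out
  have hXs : ∀ t, (X t).IsSmooth := hX.lieSystem.1.isSmooth
  have hVs := (isLieAlgebraOfFields_smallestLieAlgebra hXs).1
  have hle := smallestLieAlgebra_le_map hsec hp hsurj hXs hP
  have hPX : ∀ t, (X t).IsRelated (orbitProj G N) (P (X t)) := fun t =>
    hP _ (mem_smallestLieAlgebra X t)
  refine ⟨Θ', fun t => P (X t), fun Ω => ⟨fun h => ?_, fun h => h ▸ hΘ'⟩, fun Y =>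
      ⟨fun h => ?_, ?_⟩,
    ⟨?_, ?_, ?_⟩, ⟨?_, ?_⟩, ?_⟩
  · exact DForm.pullback_injective hsec hp hsurj (h.trans hΘ'.symm)
  · funext t
    exact VField.IsRelated.unique hsurj (h t) (hPX t)
  · rintro rfl
    exact hPX
  · exact hsec.isSmooth_of_pullback hp hsurj (by rwa [hΘ'])
  · exact hsec.isClosed_of_pullback hp hsurj (by rwa [hΘ']) (by rwa [hΘ'])
  · intro q v hv
    obtain ⟨x, rfl⟩ := hsurj q
    obtain ⟨u, rfl⟩ := hsec.surjective_mderiv hp x v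
    -- With `u` a lift of `v`, the condition that `v` annihilates `Θ'` says that `u` annihilates
    -- `ι_w Θ`. Nondegeneracy of `Θ` then makes `u` tangent to the orbit, so its projection is zero.
    obtain ⟨ζ, rfl⟩ := hβ.exists_eq hc (hΦ.nondegenerate x) (hinj x) (v := u) fun z => by
      rw [← hΘ', DForm.val_pullback]
      have h1 := congrArg (fun γ : EuclideanSpace ℝ (Fin (n - r)) [⋀^Fin m]→L[ℝ] ℝ =>
        γ fun i => mderiv _ (EuclideanSpace ℝ (Fin (n - r))) (orbitProj G N) x (z i)) hv
      refine Eq.trans (congrArg (Θ'.val (orbitProj G N x)) ?_) h1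
      funext i
      refine Fin.cases rfl (fun i => rfl) i
    have h2 := mderiv_smul_point_mem_ker (F := EuclideanSpace ℝ (Fin r)) hp hinv 1 x ζ
    rwa [one_smul] at h2
  · exact isSmoothTimeDependent_of_isRelated hsec hp hsurj hX.lieSystem.1 hPX
  · have := hX.lieSystem.2
    exact Submodule.finiteDimensional_of_le hle
  · intro Y' hY'
    obtain ⟨Y, hY, rfl⟩ := hle hY'
    -- The pullback of the contraction of `Θ'` with `P Y` is `ι_Y ι_w Θ`, which is smooth and closed
    -- on `N`.
    have h1 := (hP Y hY).pullback_contractField Θ'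
    rw [hΘ'] at h1
    refine hsec.isClosed_of_pullback hp hsurj (β := Θ'.contractField (P Y)) ?_ ?_
    · rw [h1]
      exact hsm.contractField (hVs Y hY)
    · rw [h1]
      exact hβ.isClosed_contractField hΘ.smooth hΘ.closed hcl (hVs Y hY) (hsymm Y hY)
        (hX.locallyHamiltonian Y hY)
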